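/- **Setting.** Let $\mathcal X$ be a finite or countable set and $I=I_\emptyset\subset\mathbb R$ a Borel set with Lebesgue measure $|I|\in(0,\infty)$. For every $n\ge1$ let $I=\bigcup_{(x_1,\dots,x_n)\in\mathcal X^n}I_{x_1,\dots,x_n}\cup D_n$ be a partition into pairwise disjoint sets, where the $I_{x_1,\dots,x_n}$ are open intervals (possibly empty if $n\ge2$, non-empty if $n=1$) with $I_{x_1,\dots,x_n}\subseteq I_{x_1,\dots,x_{n-1}}$, and $D_n$ consists of endpoints of non-empty intervals $I_{x_1,\dots,x_n}$. Put $\ell_{x_1,\dots,x_n}=|I_{x_1,\dots,x_n}|$ and assume $\ell_{x_1,\dots,x_n}\to0$ as $n\to\infty$ for every sequence $(x_1,x_2,\dots)$. Let $J=I\setminus\bigcup_{n\ge 1} D_n$. Every $x\in J$ has unique digits $(x_1,x_2,\dots)$ with $x\in I_{x_1,\dots,x_n}$ for all $n$, and is determined by them; write $x=.x_1x_2\dots$ and $x^{[n]}=.x_{n+1}x_{n+2}\dots$. **Hypotheses.** 1. $f$ is a probability density on $J$ that is lower semi-continuous on a Borel set $H\subseteq J$ with $|J\setminus H|=0$. 2.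 Let $s\ge1$ be an integer and $p_{x_1,\dots,x_{s+1}}=\ell_{x_1,\dots,x_{s+1}}/\ell_{x_1,\dots,x_s}$ (with $0/0=0$). For all $n\ge s+2$ and $(x_1,\dots,x_n)\in\mathcal X^n$ with $\ell_{x_1,\dots,x_{n-1}}>0$, one has $\ell_{x_1,\dots,x_n}/\ell_{x_1,\dots,x_{n-1}}=p_{x_{n-s},\dots,x_n}$. 3. Let $\Omega=\{z\in\mathcal X^s:\ell_z>0\}$, and let $P$ be the transition matrix on $\Omega$ that moves $(x_1,\dots,x_s)$ to $(x_2,\dots,x_s,y)$ with probability $p_{x_1,\dots,x_s,y}$. There is a unique $P$-invariant probability mass function $\pi_{\rm inv}$, and there are constants $\alpha$ and $\beta\in[0,1)$ with $\frac12\sum_{w\in\Omega}|P^i_{z,w}-\pi_{\rm inv}(w)|\le\alpha\beta^i$ for all $z\in\Omega$ and $i\ge1$. **Notation.** Let $\mu_{\rm inv}$ be the distribution on $J$ with density $f_{\rm inv}(x)=\pi_{\rm inv}(x_1,\dots,x_s)/\ell_{x_1,\dots,x_s}$ if $(x_1,\dots,x_s)\in\Omega$, and $0$ otherwise. Let $i_{x_1,\dots,x_n}=\inf_{H\cap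 I_{x_1,\dots,x_n}}f$ (or $0$ if this set is empty), $c_\emptyset=i_\emptyset$, and $c_{x_1,\dots,x_n}=i_{x_1,\dots,x_n}-i_{x_1,\dots,x_{n-1}}$. An *updating function* is a map $g$ that assigns to every $z\in\Omega$ a measurable map $g(z,\cdot):(0,1)\to\mathcal X$ such that $g(z,V)$ has distribution $p_{z,\cdot}$ when $V\sim\mathrm{Unif}(0,1)$. For an integer $t\ge s$ put $b=t+s-1$. Given $v_1,\dots,v_b$ and $z=(y_{1-s},\dots,y_0)\in\Omega$, set $y_i=g(y_{i-s},\dots,y_{i-1},v_i)$ for $1\le i\le b$; the block $(v_1,\dots,v_b)$ is *coalescent* if $(y_{b-s+1},\dots,y_b)$ is the same for all $z\in\Omega$. Let $\epsilon_t$ be the probability that $(V_1,\dots,V_b)$ is coalescent when the $V_i$ are i.i.d. $\mathrm{Unif}(0,1)$. **Claim.** For every $n\ge0$ the map $x\mapsto x^{[n]}\in J$ is well defined for almost every $x\in J$ and is measurable up to null sets. There exist an updating function $g$ and an integer $t\ge s$ with $\epsilon_t>0$. For all such $g$ and $t$ there is a probability space with random variables $X,N,V_1,V_2,\dots,M_1,M_2,Z$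 such that: * $X$ has density $f$, and $(X,N)$ has density $(x,n)\mapsto c_{x_1,\dots,x_n}$ with respect to the product of Lebesgue measure on $H$ and counting measure on $\{0,1,2,\dots\}$. * $V_1,V_2,\dots$ are i.i.d. $\mathrm{Unif}(0,1)$ and independent of $(X_1,\dots,X_{\max\{N,s\}},N)$, and almost surely $X_{m+i}=g(X_{m+i-s},\dots,X_{m+i-1},V_i)$ for all $i\ge1$, where $m=\max\{N,s\}$. * Almost surely, among the blocks $(V_{(i-1)b+1},\dots,V_{ib})$, $i=1,2,\dots$, the first coalescent one has number $M_1$ and the second one has number $M_1+M_2$. Moreover $M_1$ and $M_2$ are independent, geometrically distributed on $\{1,2,\dots\}$ with mean $1/\epsilon_t$, and $(M_1,M_2)$ is independent of $(X_1,\dots,X_{\max\{N,s\}},N)$. * With $K=\max\{N,s\}+b(M_1+M_2-1)-s$, one has $Z\sim\mu_{\rm inv}$ and, almost surely, $X^{[n]}=Z^{[n]}$ for all $n\ge K+s$. * With $Q^{[n]}$ the distribution of $X^{[n]}$, for every $n\ge0$, $$\|Q^{[n]}-\mu_{\rm inv}\|_{\rm TV}=\sup_{A\subseteq I\ \text{Borel}}|Q^{[n]}(A)-\mu_{\rm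 inv}(A)|\le \mathrm P(K>n),\qquad \mathrm P(K>n)\to0\ \text{ as }n\to\infty.$$ -/

import Mathlib

open MeasureTheory ProbabilityTheory Filter Topology Set

/-- Nested subdivisions of a Borel set `I = cell []` of finite positive Lebesgue measure.
A finite digit sequence `(x₁, …, xₙ)` is a list of length `n`; `cell w` is the interval with
digits `w`, and `exc n` is the exceptional set (of interval endpoints) at level `n ≥ 1`. -/
structure NestedSubdivision (𝒳 : Type*) where
  cell : List 𝒳 → Set ℝ
  exc : ℕ → Set ℝ
  measurableSet_base : MeasurableSet (cell [])
  volume_base_ne_zero : volume (cell []) ≠ 0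
  volume_base_ne_top : volume (cell []) ≠ ⊤
  base_eq : ∀ n, 1 ≤ n → cell [] = (⋃ w ∈ {w : List 𝒳 | w.length = n}, cell w) ∪ exc n
  disjoint_cell : ∀ v w : List 𝒳, v ≠ [] → v.length = w.length → v ≠ w →
    Disjoint (cell v) (cell w)
  disjoint_exc : ∀ w : List 𝒳, w ≠ [] → Disjoint (cell w) (exc w.length)
  isOpen_cell : ∀ w : List 𝒳, w ≠ [] → IsOpen (cell w)
  ordConnected_cell : ∀ w : List 𝒳, w ≠ [] → (cell w).OrdConnected
  nonempty_cell : ∀ k : 𝒳, (cell [k]).Nonempty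
  cell_append_subset : ∀ (w : List 𝒳) (k : 𝒳), cell (w ++ [k]) ⊆ cell w
  exc_subset : ∀ n, 1 ≤ n →
    exc n ⊆ ⋃ w ∈ {w : List 𝒳 | w.length = n}, frontier (cell w)
  tendsto_length : ∀ d : ℕ → 𝒳,
    Tendsto (fun n => (volume (cell ((List.range n).map d))).toReal) atTop (𝓝 0)

/-- The uniform distribution on `(0, 1)`. -/
noncomputable def unif01 : Measure ℝ := volume.restrict (Ioo 0 1)

/-- The first `n` terms of a sequence. -/
def pre {𝒳 : Type*} (d : ℕ → 𝒳) (n : ℕ) : List 𝒳 := (List.range n).map d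

/-- The `m` consecutive terms of a sequence that start at (zero-based) position `n`. -/
def window {𝒳 : Type*} (d : ℕ → 𝒳) (n m : ℕ) : List 𝒳 :=
  (List.range m).map (fun j => d (n + j))

/-- One step of a stochastic recursive sequence: the oldest digit of the state is dropped, and
the digit `g z v` is appended. -/
def srsStep {𝒳 : Type*} (g : List 𝒳 → ℝ → 𝒳) (z : List 𝒳) (v : ℝ) : List 𝒳 :=
  z.tail ++ [g z v]

/-- The output of a block of length `b` with input `z`. -/
def blockOut {𝒳 : Type*} (g : List 𝒳 → ℝ → 𝒳) {b : ℕ} (z : List 𝒳) (v : Fin b → ℝ) : List 𝒳 :=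
  (List.ofFn v).foldl (srsStep g) z

/-- The innovations used in the `i`-th block of length `b` (`i = 1, 2, …`). -/
def blockInput (b : ℕ) (V : ℕ → ℝ) (i : ℕ) : Fin b → ℝ := fun j => V ((i - 1) * b + j)

/-- `M` is geometrically distributed on `{1, 2, …}` with mean `1 / ε`. -/
def IsGeometric {Ω : Type*} [MeasurableSpace Ω] (P : Measure Ω) (M : Ω → ℕ) (ε : ℝ) :
    Prop :=
  AEMeasurable M P ∧ (∀ᵐ ω ∂P, 1 ≤ M ω) ∧ ∀ m, 1 ≤ m → P.real {ω | M ω = m} = (1 - ε) ^ (m - 1) * ε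

namespace NestedSubdivision

variable {𝒳 : Type*} (T : NestedSubdivision 𝒳)

/-- The length of the interval with digits `w`. -/
noncomputable def len (w : List 𝒳) : ℝ := (volume (T.cell w)).toReal

/-- The base set without all exceptional points. -/
def J : Set ℝ := T.cell [] \ ⋃ n ∈ {n : ℕ | 1 ≤ n}, T.exc n

/-- `d` is the digit sequence of `x`. -/
def IsDigits (d : ℕ → 𝒳) (x : ℝ) : Prop := ∀ n, x ∈ T.cell (pre d n)

open Classical in
/-- The digits of `x`; `digits x i` is the digit with number `i + 1`. -/
noncomputable def digits [Nonempty 𝒳] (x : ℝ) : ℕ → 𝒳 :=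
  if h : ∃ d, T.IsDigits d x then h.choose else fun _ => Classical.arbitrary 𝒳

open Classical in
/-- The point of `J` with digit sequence `d` (`0` if there is none). -/
noncomputable def point (d : ℕ → 𝒳) : ℝ :=
  if h : ∃ x ∈ T.J, T.IsDigits d x then h.choose else 0

/-- The `n`-th remainder of `x`: the point with digits `xₙ₊₁, xₙ₊₂, …`. -/
noncomputable def rem [Nonempty 𝒳] (n : ℕ) (x : ℝ) : ℝ :=
  T.point (fun i => T.digits x (n + i))

/-- The ratio `p` of the lengths of the intervals with digits `(z, k)` and `z`. -/
noncomputable def ratio (z : List 𝒳) (k : 𝒳) : ℝ := T.len (z ++ [k]) / T.len z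

/-- Markovian structure of order `s` of the lengths: for every `n ≥ s + 2`, the ratio of the
lengths for `(x₁, …, xₙ)` and `(x₁, …, xₙ₋₁)` is `p` of the last `s + 1` digits, whenever the
interval with digits `w = (x₁, …, xₙ₋₁)` is not empty. -/
def IsMarkov (s : ℕ) : Prop :=
  ∀ (w : List 𝒳) (k : 𝒳), s + 1 ≤ w.length → 0 < T.len w →
    T.len (w ++ [k]) / T.len w = T.ratio (w.drop (w.length - s)) k

/-- The state space of the Markov chain: digit sequences of length `s` whose interval has
positive length. -/
abbrev Adm (s : ℕ) : Type _ := {z : List 𝒳 // z.length = s ∧ 0 < T.len z}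

open Classical in
/-- The transition matrix: from `(x₁, …, xₛ)` to `(x₂, …, xₛ, y)` with probability
`p (x₁, …, xₛ, y)`. -/
noncomputable def trans (s : ℕ) (z w : T.Adm s) : ℝ :=
  if w.1.take (s - 1) = z.1.drop 1 then T.len (z.1 ++ w.1.drop (s - 1)) / T.len z.1 else 0

open Classical in
/-- The powers of the transition matrix. -/
noncomputable def transPow (s : ℕ) : ℕ → T.Adm s → T.Adm s → ℝ
  | 0, z, w => if z = w then 1 else 0
  | i + 1, z, w => ∑' u, T.trans s z u * transPow s i u w

/-- `ϖ` is an invariant probability mass function of the transition matrix. -/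
structure IsInvariantPMF (s : ℕ) (ϖ : T.Adm s → ℝ) : Prop where
  nonneg : ∀ z, 0 ≤ ϖ z
  hasSum_one : HasSum ϖ 1
  invariant : ∀ w, HasSum (fun z => ϖ z * T.trans s z w) (ϖ w)

/-- The chain is uniformly geometrically ergodic, and `ϖ` is its unique invariant probability
mass function. -/
structure IsUnifGeomErgodic (s : ℕ) (ϖ : T.Adm s → ℝ) : Prop where
  isInvariant : T.IsInvariantPMF s ϖ
  unique : ∀ ϖ' : T.Adm s → ℝ, T.IsInvariantPMF s ϖ' → ϖ' = ϖ
  rate : ∃ α β : ℝ, 0 ≤ β ∧ β < 1 ∧ ∀ (z : T.Adm s) (i : ℕ), 1 ≤ i →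
    (1 / 2) * ∑' w, |T.transPow s i z w - ϖ w| ≤ α * β ^ i

/-- `f` is a probability density function concentrated on `J`. -/
structure IsPDF (f : ℝ → ℝ) : Prop where
  measurable : Measurable f
  nonneg : ∀ x ∈ T.J, 0 ≤ f x
  lintegral_eq_one : ∫⁻ x in T.J, ENNReal.ofReal (f x) = 1

/-- The distribution on `J` with density `f`. -/
noncomputable def law (f : ℝ → ℝ) : Measure ℝ :=
  (volume.restrict T.J).withDensity (fun x => ENNReal.ofReal (f x))

open Classical in
/-- The density that has the constant value `ϖ z / len z` on the interval with digits `z`. -/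
noncomputable def pmfDensity [Nonempty 𝒳] (s : ℕ) (ϖ : T.Adm s → ℝ) (x : ℝ) : ℝ :=
  if h : (pre (T.digits x) s).length = s ∧ 0 < T.len (pre (T.digits x) s) then
    ϖ ⟨pre (T.digits x) s, h⟩ / T.len (pre (T.digits x) s) else 0

/-- The infimum of `f` over `H ∩ cell w` (`0` if this set is empty). -/
noncomputable def infOn (f : ℝ → ℝ) (H : Set ℝ) (w : List 𝒳) : ℝ := sInf (f '' (H ∩ T.cell w))

/-- The increments `c` of the infima along the nested intervals. -/
noncomputable def incr (f : ℝ → ℝ) (H : Set ℝ) (w : List 𝒳) : ℝ :=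
  if w.isEmpty then T.infOn f H [] else T.infOn f H w - T.infOn f H w.dropLast

/-- The joint distribution of `X` and the number `N` of sufficient digits: it has density
`(x, n) ↦ c (x₁, …, xₙ)` with respect to the product of Lebesgue measure on `H` and counting
measure. -/
noncomputable def jointLaw [Nonempty 𝒳] (f : ℝ → ℝ) (H : Set ℝ) : Measure (ℝ × ℕ) :=
  ((volume.restrict H).prod Measure.count).withDensity
    (fun q => ENNReal.ofReal (T.incr f H (pre (T.digits q.1) q.2)))

/-- `g` is an updating function for the chain of order `s`: for `V` uniform on `(0, 1)`, the
digit `g z V` has the distribution `p (z, ·)`, for every state `z`. -/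
structure IsUpdate (s : ℕ) (g : List 𝒳 → ℝ → 𝒳) : Prop where
  measurable : ∀ z k, MeasurableSet {v : ℝ | g z v = k}
  law_eq : ∀ (z : T.Adm s) (k : 𝒳), unif01 {v : ℝ | g z.1 v = k} = ENNReal.ofReal (T.ratio z.1 k)

/-- The block with innovations `v` is coalescent: its output is the same for all inputs. -/
def Coalescent (s : ℕ) (g : List 𝒳 → ℝ → 𝒳) {b : ℕ} (v : Fin b → ℝ) : Prop :=
  ∀ z z' : T.Adm s, blockOut g z.1 v = blockOut g z'.1 v

/-- The probability that a block of length `b` is coalescent. -/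
noncomputable def coalProb (s : ℕ) (g : List 𝒳 → ℝ → 𝒳) (b : ℕ) : ℝ :=
  (Measure.pi (fun _ : Fin b => unif01)).real {v | T.Coalescent s g v}

/-- The discrete random variable `(X₁, …, X_{max(N, s)}, N)`. -/
noncomputable def head [Nonempty 𝒳] (s : ℕ) (x : ℝ) (n : ℕ) : List 𝒳 × ℕ :=
  (pre (T.digits x) (max n s), n)

/-- `(X₁, …, X_{max(N, s)}, N)`, as a discrete random variable, is independent of `Y`. -/
def HeadIndep [Nonempty 𝒳] (s : ℕ) {Ω : Type*} [MeasurableSpace Ω] (P : Measure Ω)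
    (X : Ω → ℝ) (N : Ω → ℕ) {β : Type*} [MeasurableSpace β] (Y : Ω → β) : Prop :=
  Indep (MeasurableSpace.comap (fun ω => T.head s (X ω) (N ω)) ⊤)
    (MeasurableSpace.comap Y inferInstance) P

/-- The coupling of `(X, N)` with the innovations `V` and the times `M₁, M₂` of the read once
algorithm with updating function `g` and block length `b`, where the first block starts just after
time `max(N, s)`: the digits of `X` after time `max(N, s)` are generated from the independent
innovations `V`, the first coalescent block has number `M₁`, and the second one has number
`M₁ + M₂`. -/
structure IsReadOnceCoupling [Nonempty 𝒳] (s : ℕ) (f : ℝ → ℝ) (H : Set ℝ)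
    (g : List 𝒳 → ℝ → 𝒳) (b : ℕ) {Ω : Type*} [MeasurableSpace Ω] (P : Measure Ω)
    (X : Ω → ℝ) (N : Ω → ℕ) (V : ℕ → Ω → ℝ) (M₁ M₂ : Ω → ℕ) : Prop where
  law_X : HasLaw X (T.law f) P
  law_XN : HasLaw (fun ω => (X ω, N ω)) (T.jointLaw f H) P
  law_V : ∀ i, HasLaw (V i) unif01 P
  iIndep_V : iIndepFun V P
  indep_head_V : T.HeadIndep s P X N (fun ω i => V i ω)
  digits_eq : ∀ᵐ ω ∂P, ∀ i, T.digits (X ω) (max (N ω) s + i) =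
    g (window (T.digits (X ω)) (max (N ω) s + i - s) s) (V i ω)
  coalescent_iff : ∀ᵐ ω ∂P, 1 ≤ M₁ ω ∧ 1 ≤ M₂ ω ∧ ∀ i, 1 ≤ i → i ≤ M₁ ω + M₂ ω →
    (T.Coalescent s g (blockInput b (fun j => V j ω) i) ↔ i = M₁ ω ∨ i = M₁ ω + M₂ ω)

/-- The total variation distance on the Borel subsets of the base set. -/
noncomputable def tvDist (μ ν : Measure ℝ) : ℝ :=
  ⨆ A : {A : Set ℝ // MeasurableSet A ∧ A ⊆ T.cell []}, |μ.real A.1 - ν.real A.1|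

end NestedSubdivision

/-! Coding points by digits turns the claim into one about sequences: `digits` maps `J` bijectively
onto `digitRange`, with inverse `point`, measurably both ways. The Markov hypothesis gives
ℓ(uzv)ℓ(z) = ℓ(uz)ℓ(zv) for z of length s (`IsMarkov.len_mul_len`). So under Lebesgue measure on a
cell with at least s fixed digits, the later digits form a Markov chain of order s and can be
generated from i.i.d. uniform innovations by any updating function (`unifSeq_map_extSeq`). A density
that depends on the first m ≥ s digits only is therefore unchanged when all later digits are
generated anew (`lintegral_restart`).

By lower semicontinuity the infima of f over nested cells increase to f (`tendsto_infOn`), so f is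
the sum of the increments c, and given N = n the density of X depends on the first n digits only.
The invariant density depends on the first s. Take independently a pair with the joint law of (X,
N), a point with law μ_inv, and innovations V; keep the first max(N, s) digits of both points and
continue both with the same V. Both laws are preserved, V is independent of the head of X, and a
coalescent block brings both chains to the same state, after which all digits agree
(`Coalescent.eq_of_le`). The blocks are i.i.d., so M₁ and M₂ are waiting times in Bernoulli trials.
Since μ_inv is invariant under remainders (`IsInvariantPMF.map_rem`), the coupling inequality gives
the bound, and P(K > n) → 0 because K is finite.

Coalescent blocks exist (`exists_update_coalProb_pos`) because some state w is reached in b steps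
from every state with probability at least δ > 0. An updating function does not see the time within
the block, so the innovation carries a guess of it and a rare success flag. With a correct guess and
a raised flag, the digit is chosen so that the bound on the probability of reaching w in the
remaining time is at worst halved. If this happens in all b steps, a positive bound is left at time
0, so every start has ended in w. -/

set_option linter.unusedSectionVars false

/-! ### Prefixes and windows of sequences -/

section Lists

variable {𝒳 : Type*}

@[simp] lemma pre_zero (d : ℕ → 𝒳) : pre d 0 = [] := rfl

@[simp] lemma length_pre (d : ℕ → 𝒳) (n : ℕ) : (pre d n).length = n := by simp [pre]

@[simp] lemma length_window (d : ℕ → 𝒳) (n m : ℕ) : (window d n m).length = m := by simp [window]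

lemma pre_succ (d : ℕ → 𝒳) (n : ℕ) : pre d (n + 1) = pre d n ++ [d n] := by
  simp [pre, List.range_succ]

lemma window_eq_pre (d : ℕ → 𝒳) (n m : ℕ) : window d n m = pre (fun j => d (n + j)) m := rfl

lemma pre_add (d : ℕ → 𝒳) (n m : ℕ) : pre d (n + m) = pre d n ++ window d n m := by
  induction m with
  | zero => simp [window]
  | succ m ih => rw [← add_assoc, pre_succ, ih, window_eq_pre, window_eq_pre, pre_succ]; simp

lemma drop_pre (d : ℕ → 𝒳) (n m : ℕ) : (pre d (n + m)).drop n = window d n m := by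
  rw [pre_add, List.drop_left' (by simp)]

lemma pre_eq_pre_iff {d d' : ℕ → 𝒳} {n : ℕ} : pre d n = pre d' n ↔ ∀ i < n, d i = d' i := by
  simp [pre]

lemma pre_eq_of_le {d d' : ℕ → 𝒳} {n m : ℕ} (h : pre d n = pre d' n) (hm : m ≤ n) :
    pre d m = pre d' m :=
  pre_eq_pre_iff.2 fun i hi => pre_eq_pre_iff.1 h i (hi.trans_le hm)

lemma pre_getD (w : List 𝒳) (a : 𝒳) : pre (fun i => w.getD i a) w.length = w := by
  apply List.ext_getElem
  · simp
  · intro i h1 h2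
    simp [pre, h2]

lemma exists_pre_eq [Nonempty 𝒳] (w : List 𝒳) : ∃ d, pre d w.length = w :=
  ⟨_, pre_getD w (Classical.arbitrary 𝒳)⟩

lemma window_tail_append {d : ℕ → 𝒳} {n m : ℕ} (hm : 1 ≤ m) :
    (window d n m).tail ++ [d (n + m)] = window d (n + 1) m := by
  obtain ⟨m, rfl⟩ := Nat.exists_eq_add_of_le' hm
  apply List.ext_getElem
  · simp
  · intro i h1 h2
    rw [length_window] at h2
    rw [List.getElem_append]
    split_ifs with h
    · simp [window, add_assoc, add_comm 1]
    · have : i = m := by simp at h; omega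
      subst this
      simp [window, add_assoc, add_comm 1]

lemma drop_append_length_sub {u z : List 𝒳} {s : ℕ} (hz : z.length = s) :
    (u ++ z).drop ((u ++ z).length - s) = z := by
  simp [hz]

end Lists

namespace NestedSubdivision

variable {𝒳 : Type*} (T : NestedSubdivision 𝒳)

/-! ### Digits and points -/

section Geometry

lemma cell_append_subset' (w u : List 𝒳) : T.cell (w ++ u) ⊆ T.cell w := by
  induction u using List.reverseRecOn with
  | nil => simp
  | append_singleton u k ih =>
    rw [← List.append_assoc]
    exact (T.cell_append_subset _ _).trans ih

lemma cell_subset_base (w : List 𝒳) : T.cell w ⊆ T.cell [] := T.cell_append_subset' [] w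

lemma volume_cell_ne_top (w : List 𝒳) : volume (T.cell w) ≠ ⊤ :=
  measure_ne_top_of_subset (T.cell_subset_base w) T.volume_base_ne_top

lemma measurableSet_cell (w : List 𝒳) : MeasurableSet (T.cell w) := by
  by_cases h : w = []
  · exact h ▸ T.measurableSet_base
  · exact (T.isOpen_cell w h).measurableSet

lemma len_nonneg (w : List 𝒳) : 0 ≤ T.len w := ENNReal.toReal_nonneg

lemma ofReal_len (w : List 𝒳) : ENNReal.ofReal (T.len w) = volume (T.cell w) :=
  ENNReal.ofReal_toReal (T.volume_cell_ne_top w)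

lemma len_pos_of_nonempty {w : List 𝒳} (h : (T.cell w).Nonempty) : 0 < T.len w := by
  refine ENNReal.toReal_pos ?_ (T.volume_cell_ne_top w)
  by_cases hw : w = []
  · exact hw ▸ T.volume_base_ne_zero
  · exact ((T.isOpen_cell w hw).measure_pos volume h).ne'

lemma len_append_le (w u : List 𝒳) : T.len (w ++ u) ≤ T.len w :=
  ENNReal.toReal_mono (T.volume_cell_ne_top w) (measure_mono (T.cell_append_subset' w u))

lemma eq_of_mem_cell {x : ℝ} {v w : List 𝒳} (h : v.length = w.length) (hv : x ∈ T.cell v)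
    (hw : x ∈ T.cell w) : v = w := by
  by_contra hne
  have hv0 : v ≠ [] := by
    rintro rfl
    exact hne (List.length_eq_zero_iff.1 h.symm).symm
  exact (T.disjoint_cell v w hv0 h hne).le_bot ⟨hv, hw⟩

lemma IsDigits.unique {T : NestedSubdivision 𝒳} {d d' : ℕ → 𝒳} {x : ℝ} (h : T.IsDigits d x)
    (h' : T.IsDigits d' x) : d = d' := by
  funext i
  exact pre_eq_pre_iff.1 (T.eq_of_mem_cell (by simp) (h (i + 1)) (h' (i + 1))) i (by simp)

lemma IsDigits.mem_J {T : NestedSubdivision 𝒳} {d : ℕ → 𝒳} {x : ℝ} (h : T.IsDigits d x) :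
    x ∈ T.J := by
  refine ⟨h 0, ?_⟩
  simp only [mem_ofPred_eq, mem_iUnion, not_exists]
  intro n hn hx
  have hne : pre d n ≠ [] := by
    intro h0
    have := congrArg List.length h0
    simp at this
    omega
  refine (T.disjoint_exc (pre d n) hne).le_bot ⟨h n, ?_⟩
  simpa using hx

lemma exists_isDigits [Nonempty 𝒳] {x : ℝ} (hx : x ∈ T.J) : ∃ d, T.IsDigits d x := by
  have key : ∀ n, ∃ w : List 𝒳, w.length = n ∧ x ∈ T.cell w := by
    intro n
    rcases Nat.eq_zero_or_pos n with rfl | hn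
    · exact ⟨[], rfl, hx.1⟩
    · have h1 := hx.1
      rw [T.base_eq n hn] at h1
      rcases h1 with h1 | h1
      · simp only [mem_ofPred_eq, mem_iUnion] at h1
        obtain ⟨w, hw, hxw⟩ := h1
        exact ⟨w, hw, hxw⟩
      · exact absurd (mem_biUnion (show n ∈ {n : ℕ | 1 ≤ n} from hn) h1) hx.2
  choose W hW hxW using key
  let a := Classical.arbitrary 𝒳
  refine ⟨fun i => (W (i + 1)).getD i a, fun n => ?_⟩
  suffices h : pre (fun i => (W (i + 1)).getD i a) n = W n from h ▸ hxW n
  induction n with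
  | zero => exact (List.length_eq_zero_iff.1 (hW 0)).symm
  | succ n ih =>
    -- Distinct cells of one level are disjoint, so the words chosen separately at each level must
    -- extend one another.
    have h1 : (W (n + 1)).take n = W n := by
      refine T.eq_of_mem_cell (x := x) (by simp [hW]) ?_ (hxW n)
      apply T.cell_append_subset' _ ((W (n + 1)).drop n)
      rw [List.take_append_drop]
      exact hxW _
    have h2 : n < (W (n + 1)).length := by simp [hW]
    rw [pre_succ, ih, ← h1, List.getD_eq_getElem _ _ h2, List.take_append_getElem h2,
      List.take_of_length_le (by simp [hW])]

lemma mem_J_iff [Nonempty 𝒳] {x : ℝ} : x ∈ T.J ↔ ∃ d, T.IsDigits d x :=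
  ⟨T.exists_isDigits, fun ⟨_, h⟩ => h.mem_J⟩

lemma isDigits_digits [Nonempty 𝒳] {x : ℝ} (hx : x ∈ T.J) : T.IsDigits (T.digits x) x := by
  have h := T.exists_isDigits hx
  rw [digits, dif_pos h]
  exact h.choose_spec

lemma IsDigits.digits_eq [Nonempty 𝒳] {T : NestedSubdivision 𝒳} {d : ℕ → 𝒳} {x : ℝ}
    (h : T.IsDigits d x) : T.digits x = d :=
  (T.isDigits_digits h.mem_J).unique h

lemma mem_cell_iff [Nonempty 𝒳] {x : ℝ} (hx : x ∈ T.J) {w : List 𝒳} {n : ℕ} (hw : w.length = n) :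
    x ∈ T.cell w ↔ pre (T.digits x) n = w := by
  have h := T.isDigits_digits hx n
  exact ⟨fun h' => T.eq_of_mem_cell (by simp [hw]) h h', fun h' => h' ▸ h⟩

lemma dist_le_len {w : List 𝒳} (hw : w ≠ []) {x y : ℝ} (hx : x ∈ T.cell w) (hy : y ∈ T.cell w) :
    |x - y| ≤ T.len w := by
  wlog hxy : x ≤ y generalizing x y
  · rw [abs_sub_comm]
    exact this hy hx (le_of_not_ge hxy)
  have h := (T.ordConnected_cell w hw).out hx hy
  have h2 := measure_mono (μ := volume) h
  rw [Real.volume_Icc] at h2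
  have h3 := ENNReal.toReal_mono (T.volume_cell_ne_top w) h2
  rw [ENNReal.toReal_ofReal (by linarith)] at h3
  rw [abs_sub_comm, abs_of_nonneg (by linarith)]
  exact h3

lemma tendsto_len (d : ℕ → 𝒳) : Tendsto (fun n => T.len (pre d n)) atTop (𝓝 0) :=
  T.tendsto_length d

lemma pre_ne_nil (d : ℕ → 𝒳) {n : ℕ} (hn : 1 ≤ n) : pre d n ≠ [] := by
  intro h0
  have := congrArg List.length h0
  simp at this
  omega

/-- Both points lie in one interval at every level, and the lengths of these intervals tend to zero.
-/
lemma IsDigits.eq {T : NestedSubdivision 𝒳} {d : ℕ → 𝒳} {x y : ℝ} (hx : T.IsDigits d x)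
    (hy : T.IsDigits d y) : x = y := by
  have h : |x - y| ≤ 0 := by
    refine ge_of_tendsto (T.tendsto_len d) ?_
    filter_upwards [eventually_ge_atTop 1] with n hn
    exact T.dist_le_len (pre_ne_nil d hn) (hx n) (hy n)
  exact sub_eq_zero.1 (abs_nonpos_iff.1 h)

lemma IsDigits.point_eq {T : NestedSubdivision 𝒳} {d : ℕ → 𝒳} {x : ℝ} (h : T.IsDigits d x) :
    T.point d = x := by
  have h' : ∃ x ∈ T.J, T.IsDigits d x := ⟨x, h.mem_J, h⟩
  rw [point, dif_pos h']
  exact h'.choose_spec.2.eq h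

lemma point_digits [Nonempty 𝒳] {x : ℝ} (hx : x ∈ T.J) : T.point (T.digits x) = x :=
  (T.isDigits_digits hx).point_eq

/-- The sequences that are digit sequences of points. -/
def digitRange [Nonempty 𝒳] : Set (ℕ → 𝒳) := T.digits '' T.J

lemma mem_digitRange_iff [Nonempty 𝒳] {d : ℕ → 𝒳} :
    d ∈ T.digitRange ↔ T.IsDigits d (T.point d) := by
  constructor
  · rintro ⟨x, hx, rfl⟩
    rw [T.point_digits hx]
    exact T.isDigits_digits hx
  · exact fun h => ⟨_, h.mem_J, h.digits_eq⟩

lemma point_mem_J [Nonempty 𝒳] {d : ℕ → 𝒳} (h : d ∈ T.digitRange) : T.point d ∈ T.J :=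
  (T.mem_digitRange_iff.1 h).mem_J

lemma digits_point [Nonempty 𝒳] {d : ℕ → 𝒳} (h : d ∈ T.digitRange) : T.digits (T.point d) = d :=
  (T.mem_digitRange_iff.1 h).digits_eq

lemma digits_injOn [Nonempty 𝒳] : InjOn T.digits T.J := by
  intro x hx y hy h
  rw [← T.point_digits hx, h, T.point_digits hy]

lemma digits_of_notMem [Nonempty 𝒳] {x : ℝ} (hx : x ∉ T.J) :
    T.digits x = fun _ => Classical.arbitrary 𝒳 := by
  rw [digits, dif_neg]
  rwa [← T.mem_J_iff]

lemma point_of_notMem [Nonempty 𝒳] {d : ℕ → 𝒳} (hd : d ∉ T.digitRange) : T.point d = 0 := by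
  rw [point, dif_neg]
  rintro ⟨x, hx, h⟩
  exact hd ⟨x, hx, h.digits_eq⟩

end Geometry

/-! ### Null sets and measurability of the coding -/

section Measurability

variable [Countable 𝒳]

lemma measurableSet_exc {n : ℕ} (hn : 1 ≤ n) : MeasurableSet (T.exc n) := by
  have h : T.exc n = T.cell [] \ ⋃ w ∈ {w : List 𝒳 | w.length = n}, T.cell w := by
    rw [T.base_eq n hn, union_sdiff_left, eq_comm, sdiff_eq_left]
    rw [disjoint_comm, disjoint_iUnion₂_left]
    intro w hw
    have hw' : w.length = n := hw
    have := T.disjoint_exc w (by rintro rfl; simp at hw'; omega)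
    rwa [hw'] at this
  rw [h]
  exact T.measurableSet_base.diff
    (MeasurableSet.biUnion (to_countable _) fun w _ => T.measurableSet_cell w)

lemma volume_exc {n : ℕ} (hn : 1 ≤ n) : volume (T.exc n) = 0 := by
  refine measure_mono_null (T.exc_subset n hn) ?_
  rw [measure_biUnion_null_iff (to_countable _)]
  intro w hw
  have hw' : w.length = n := hw
  exact (T.ordConnected_cell w (by rintro rfl; simp at hw'; omega)).convex.addHaar_frontier volume

lemma measurableSet_J : MeasurableSet T.J :=
  T.measurableSet_base.diff (MeasurableSet.biUnion (to_countable _) fun _ h => T.measurableSet_exc h)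

lemma volume_base_diff_J : volume (T.cell [] \ T.J) = 0 := by
  rw [J, sdiff_sdiff_right_self]
  refine measure_mono_null inter_subset_right ?_
  rw [measure_biUnion_null_iff (to_countable _)]
  exact fun n hn => T.volume_exc hn

lemma volume_J_inter_cell (w : List 𝒳) : volume (T.J ∩ T.cell w) = volume (T.cell w) := by
  refine le_antisymm (measure_mono inter_subset_right) ?_
  have h : T.cell w ⊆ (T.J ∩ T.cell w) ∪ (T.cell [] \ T.J) := by
    intro x hx
    by_cases hJ : x ∈ T.J
    · exact Or.inl ⟨hJ, hx⟩
    · exact Or.inr ⟨T.cell_subset_base w hx, hJ⟩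
  calc volume (T.cell w) ≤ _ := measure_mono h
    _ ≤ _ := measure_union_le _ _
    _ = _ := by rw [T.volume_base_diff_J, add_zero]

/-- Inside `J`, which has full measure, a cell is the disjoint union of its children. -/
lemma volume_cell_eq_tsum (w : List 𝒳) :
    volume (T.cell w) = ∑' k, volume (T.cell (w ++ [k])) := by
  have hd : Pairwise (Function.onFun Disjoint fun k => T.J ∩ T.cell (w ++ [k])) := by
    intro k k' hk
    refine (T.disjoint_cell (w ++ [k]) (w ++ [k']) (by simp) (by simp) (by simpa using hk)).mono ?_ ?_ <;>
      exact inter_subset_right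
  have hU : T.J ∩ T.cell w = ⋃ k, T.J ∩ T.cell (w ++ [k]) := by
    ext x
    simp only [mem_inter_iff, mem_iUnion]
    constructor
    · rintro ⟨hx, hw⟩
      have : Nonempty 𝒳 := by
        have h1 := hx.1
        rw [T.base_eq 1 le_rfl] at h1
        rcases h1 with h1 | h1
        · simp only [mem_ofPred_eq, mem_iUnion] at h1
          obtain ⟨v, hv, -⟩ := h1
          exact ⟨v.head (by rintro rfl; simp at hv)⟩
        · exact absurd (mem_biUnion (show 1 ∈ {n : ℕ | 1 ≤ n} from le_refl 1) h1) hx.2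
      refine ⟨T.digits x w.length, hx, ?_⟩
      rw [T.mem_cell_iff hx (n := w.length + 1) (by simp), pre_succ,
        (T.mem_cell_iff hx rfl).1 hw]
    · rintro ⟨k, hx, hw⟩
      exact ⟨hx, T.cell_append_subset _ _ hw⟩
  rw [← T.volume_J_inter_cell w, hU,
    measure_iUnion hd fun k => T.measurableSet_J.inter (T.measurableSet_cell _)]
  simp_rw [T.volume_J_inter_cell]

variable [Nonempty 𝒳] [MeasurableSpace 𝒳] [DiscreteMeasurableSpace 𝒳]

lemma measurable_comp_pre {β : Type*} [MeasurableSpace β] (n : ℕ) (F : List 𝒳 → β) :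
    Measurable fun d : ℕ → 𝒳 => F (pre d n) := by
  have h : (fun d : ℕ → 𝒳 => F (pre d n)) =
      (fun e : Fin n → 𝒳 => F (List.ofFn e)) ∘ fun d i => d i := by
    funext d
    simp only [Function.comp]
    congr 1
    apply List.ext_getElem <;> simp [pre]
  rw [h]
  exact (measurable_of_countable _).comp (by fun_prop)

lemma measurableSet_pre (n : ℕ) (p : List 𝒳 → Prop) :
    MeasurableSet {d : ℕ → 𝒳 | p (pre d n)} :=
  measurableSet_setOfPred.2 (measurable_comp_pre n p)

lemma measurable_digits : Measurable T.digits := by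
  rw [measurable_pi_iff]
  intro i
  refine measurable_to_countable' fun k => ?_
  have h : (fun x => T.digits x i) ⁻¹' {k} =
      (T.J ∩ ⋃ w ∈ {w : List 𝒳 | w.length = i ∧ True}, T.cell (w ++ [k])) ∪
      (T.Jᶜ ∩ {_x | Classical.arbitrary 𝒳 = k}) := by
    ext x
    simp only [mem_preimage, mem_singleton_iff, mem_union, mem_inter_iff, mem_ofPred_eq, and_true,
      mem_iUnion, mem_compl_iff]
    by_cases hx : x ∈ T.J
    · simp only [hx, true_and, not_true_eq_false, false_and, or_false]
      constructor
      · rintro rfl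
        exact ⟨_, length_pre (T.digits x) i, pre_succ (T.digits x) i ▸ T.isDigits_digits hx (i + 1)⟩
      · rintro ⟨w, hw, hxw⟩
        rw [T.mem_cell_iff hx (n := i + 1) (by simp [hw]), pre_succ] at hxw
        simpa using (List.append_inj' hxw rfl).2
    · simp [hx, T.digits_of_notMem hx]
  rw [h]
  exact (T.measurableSet_J.inter (MeasurableSet.biUnion (to_countable _)
    fun w _ => T.measurableSet_cell _)).union (T.measurableSet_J.compl.inter (.const _))

lemma measurableSet_digitRange : MeasurableSet T.digitRange :=
  T.measurableSet_J.image_of_measurable_injOn T.measurable_digits T.digits_injOn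

/-- Lusin–Souslin: the injective measurable map `digits` sends Borel subsets of `J` to Borel sets,
so its inverse is measurable on `digitRange`. Elsewhere `point` has the default value 0. -/
lemma measurable_point : Measurable T.point := by
  intro A hA
  have h : T.point ⁻¹' A = (T.digits '' (A ∩ T.J)) ∪ (T.digitRangeᶜ ∩ {_d | (0 : ℝ) ∈ A}) := by
    ext d
    simp only [mem_preimage, mem_union, mem_inter_iff, mem_compl_iff, mem_ofPred_eq]
    by_cases hd : d ∈ T.digitRange
    · simp only [hd, not_true_eq_false, false_and, or_false]
      constructor
      · exact fun h => ⟨_, ⟨h, T.point_mem_J hd⟩, T.digits_point hd⟩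
      · rintro ⟨x, ⟨hxA, hx⟩, rfl⟩
        rwa [T.point_digits hx]
    · have hd' : d ∉ T.digits '' (A ∩ T.J) := fun h => hd (image_mono inter_subset_right h)
      simp [hd, hd', T.point_of_notMem hd]
  rw [h]
  exact ((hA.inter T.measurableSet_J).image_of_measurable_injOn T.measurable_digits
    (T.digits_injOn.mono inter_subset_right)).union
    (T.measurableSet_digitRange.compl.inter (.const _))

lemma measurable_rem (n : ℕ) : Measurable (T.rem n) := by
  have h : Measurable fun x => fun i => T.digits x (n + i) :=
    measurable_pi_iff.2 fun i => (measurable_pi_apply _).comp T.measurable_digits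
  exact T.measurable_point.comp h

end Measurability

/-! ### Factorization of lengths -/

section Markov

variable [Countable 𝒳] {T} {s : ℕ}

lemma tsum_ratio {z : List 𝒳} (hz : 0 < T.len z) : ∑' k, ENNReal.ofReal (T.ratio z k) = 1 := by
  have h0 : volume (T.cell z) ≠ 0 := by
    rw [← T.ofReal_len]; simpa using hz
  simp_rw [ratio, ENNReal.ofReal_div_of_pos hz, T.ofReal_len, div_eq_mul_inv]
  rw [ENNReal.tsum_mul_right, ← T.volume_cell_eq_tsum,
    ENNReal.mul_inv_cancel h0 (T.volume_cell_ne_top z)]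

lemma IsMarkov.len_append_singleton (hM : T.IsMarkov s) {w : List 𝒳} (hw : s ≤ w.length)
    (hpos : 0 < T.len w) (k : 𝒳) :
    T.len (w ++ [k]) = T.len w * T.ratio (w.drop (w.length - s)) k := by
  -- The Markov hypothesis starts at length s + 1; at length s the formula is the definition of
  -- `ratio`.
  rcases hw.eq_or_lt with h | h
  · rw [← h, Nat.sub_self, List.drop_zero, ratio]
    field_simp
  · rw [← hM w k h hpos]
    field_simp

/-- If `z` had length zero, then, division by zero being zero, all ratios at `z` would vanish. All
children of the cell of `u ++ z` would be null, although their lengths add up to its length. -/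
lemma IsMarkov.len_pos_of_append (hM : T.IsMarkov s) {u z : List 𝒳} (hz : z.length = s)
    (h : 0 < T.len (u ++ z)) : 0 < T.len z := by
  rcases List.eq_nil_or_concat u with rfl | ⟨u', a, rfl⟩
  · simpa using h
  by_contra h0
  have h0' : T.len z = 0 := le_antisymm (not_lt.1 h0) (T.len_nonneg _)
  have h1 : ∀ k, T.len (u' ++ [a] ++ z ++ [k]) = 0 := by
    intro k
    rw [List.concat_eq_append] at h
    rw [hM.len_append_singleton (by simp [hz]; omega) h, drop_append_length_sub hz]
    simp [ratio, h0']
  have h2 := T.volume_cell_eq_tsum (u' ++ [a] ++ z)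
  simp_rw [← T.ofReal_len, h1] at h2
  simp at h2
  rw [List.concat_eq_append] at h
  simp at h
  linarith

/-- Past and future are independent given the s digits `z`: one more digit multiplies both sides by
the same ratio, because the last s digits agree. The form without division also covers null cells.
-/
lemma IsMarkov.len_mul_len (hM : T.IsMarkov s) (u : List 𝒳) {z : List 𝒳} (hz : z.length = s)
    (v : List 𝒳) : T.len (u ++ z ++ v) * T.len z = T.len (u ++ z) * T.len (z ++ v) := by
  induction v using List.reverseRecOn with
  | nil => simp
  | append_singleton v k ih =>
    simp only [← List.append_assoc]
    rcases (T.len_nonneg (u ++ z ++ v)).eq_or_lt with h0 | hpos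
    · have h1 : T.len (u ++ z ++ v ++ [k]) = 0 :=
        le_antisymm (h0 ▸ T.len_append_le _ _) (T.len_nonneg _)
      rw [← h0, zero_mul, eq_comm, mul_eq_zero] at ih
      rw [h1, zero_mul, eq_comm, mul_eq_zero]
      refine ih.imp_right fun h => le_antisymm (h ▸ T.len_append_le _ _) (T.len_nonneg _)
    · have hz0 : 0 < T.len z :=
        hM.len_pos_of_append hz (hpos.trans_le (T.len_append_le _ _))
      have hzv : 0 < T.len (z ++ v) := by
        refine (T.len_nonneg _).lt_of_ne fun h => ?_
        rw [← h, mul_zero] at ih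
        exact (mul_pos hpos hz0).ne' ih
      rw [hM.len_append_singleton (by simp [hz]; omega) hpos,
        hM.len_append_singleton (by simp [hz]) hzv]
      have hd : (u ++ z ++ v).drop ((u ++ z ++ v).length - s) =
          (z ++ v).drop ((z ++ v).length - s) := by
        rw [List.append_assoc, show (u ++ (z ++ v)).length - s = u.length + ((z ++ v).length - s) by
          simp [hz]; omega, List.drop_append]
        simp
      rw [hd, mul_right_comm, ih]
      ring

end Markov

end NestedSubdivision

/-! ### Cylinders determine finite measures -/

section Cylinders

variable {𝒳 : Type*} [Countable 𝒳] [Nonempty 𝒳] [MeasurableSpace 𝒳] [DiscreteMeasurableSpace 𝒳]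

/-- Short cylinders are dispensable: an event about coordinate i is a countable union of cylinders
of length `max m (i + 1)`. -/
lemma generateFrom_cylinders (m : ℕ) : (MeasurableSpace.pi : MeasurableSpace (ℕ → 𝒳)) =
    MeasurableSpace.generateFrom
      {S | S = ∅ ∨ ∃ n d, m ≤ n ∧ S = {d' : ℕ → 𝒳 | pre d' n = pre d n}} := by
  refine le_antisymm ?_ (MeasurableSpace.generateFrom_le ?_)
  · refine iSup_le fun i => ?_
    rw [← measurable_iff_comap_le]
    refine @measurable_to_countable' _ _ (_) _ (_) _ fun k => ?_
    have h : (fun d : ℕ → 𝒳 => d i) ⁻¹' {k} = ⋃ w ∈ {w : List 𝒳 | w.length = max m (i + 1) ∧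
        ∃ d, pre d (max m (i + 1)) = w ∧ d i = k}, {d' | pre d' (max m (i + 1)) = w} := by
      ext d
      simp only [mem_preimage, mem_singleton_iff, mem_iUnion, mem_ofPred_eq]
      constructor
      · rintro rfl
        exact ⟨_, ⟨length_pre d _, d, rfl, rfl⟩, rfl⟩
      · rintro ⟨w, ⟨-, d', rfl, rfl⟩, h⟩
        exact pre_eq_pre_iff.1 h i (by simp)
    rw [h]
    refine @MeasurableSet.biUnion _ _ (_) _ _ (to_countable _) ?_
    rintro w ⟨-, d, rfl, -⟩
    exact MeasurableSpace.measurableSet_generateFrom (Or.inr ⟨_, d, le_max_left _ _, rfl⟩)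
  · rintro S (rfl | ⟨n, d, -, rfl⟩)
    · exact MeasurableSet.empty
    · exact NestedSubdivision.measurableSet_pre n fun w => w = pre d n

lemma isPiSystem_cylinders (m : ℕ) : IsPiSystem
    {S | S = ∅ ∨ ∃ n d, m ≤ n ∧ S = {d' : ℕ → 𝒳 | pre d' n = pre d n}} := by
  rintro _ (rfl | ⟨n, d, hn, rfl⟩) _ (rfl | ⟨n', d', hn', rfl⟩) hne
  · simp
  · simp
  · simp
  · obtain ⟨e, he, he'⟩ := hne
    refine Or.inr ⟨max n n', e, hn.trans (le_max_left _ _), ?_⟩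
    ext e'
    simp only [mem_inter_iff, mem_ofPred_eq] at he he' ⊢
    rw [← he, ← he']
    refine ⟨fun h => ?_, fun h => ⟨pre_eq_of_le h (le_max_left _ _),
      pre_eq_of_le h (le_max_right _ _)⟩⟩
    rcases max_cases n n' with h' | h'
    · rw [h'.1]; exact h.1
    · rw [h'.1]; exact h.2

/-- Finite measures on the space of sequences are determined by the cylinders of large length. -/
lemma measure_eq_of_cylinders {μ ν : Measure (ℕ → 𝒳)} [IsFiniteMeasure μ] (m : ℕ)
    (h : ∀ d n, m ≤ n → μ {d' | pre d' n = pre d n} = ν {d' | pre d' n = pre d n}) : μ = ν := by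
  refine Measure.ext_of_generateFrom_of_cover_subset (generateFrom_cylinders m)
    (isPiSystem_cylinders m) (T := range fun w : {w : List 𝒳 // ∃ d, pre d m = w} =>
      {d' : ℕ → 𝒳 | pre d' m = w.1}) ?_ (countable_range _) ?_ ?_ ?_
  · rintro _ ⟨⟨w, d, rfl⟩, rfl⟩
    exact Or.inr ⟨m, d, le_rfl, rfl⟩
  · rw [sUnion_range, iUnion_eq_univ_iff]
    exact fun d => ⟨⟨_, d, rfl⟩, rfl⟩
  · exact fun _ _ => measure_ne_top _ _
  · rintro _ (rfl | ⟨n, d, hn, rfl⟩)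
    · simp
    · exact h d n hn

end Cylinders

/-! ### Laws of digits on cells, and the shift -/

namespace NestedSubdivision

variable {𝒳 : Type*} [Countable 𝒳] [Nonempty 𝒳] [MeasurableSpace 𝒳] [DiscreteMeasurableSpace 𝒳]
  {T : NestedSubdivision 𝒳} {s : ℕ}

variable (T) in
/-- The distribution of the digits under Lebesgue measure on the interval with digits `w`. -/
noncomputable def cellLaw (w : List 𝒳) : Measure (ℕ → 𝒳) :=
  (volume.restrict (T.J ∩ T.cell w)).map T.digits

instance (w : List 𝒳) : IsFiniteMeasure (volume.restrict (T.J ∩ T.cell w)) :=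
  ⟨by rw [Measure.restrict_apply_univ, T.volume_J_inter_cell]; exact (T.volume_cell_ne_top w).lt_top⟩

instance (w : List 𝒳) : IsFiniteMeasure (T.cellLaw w) := by
  unfold cellLaw; infer_instance

lemma cellLaw_cylinder {d : ℕ → 𝒳} {m n : ℕ} (hmn : m ≤ n) :
    T.cellLaw (pre d m) {d' | pre d' n = pre d n} = volume (T.cell (pre d n)) := by
  rw [cellLaw, Measure.map_apply T.measurable_digits (measurableSet_pre n fun w => w = pre d n),
    Measure.restrict_apply (T.measurable_digits (measurableSet_pre n fun w => w = pre d n)),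
    ← T.volume_J_inter_cell]
  congr 1
  ext x
  simp only [mem_inter_iff, mem_preimage, mem_ofPred_eq]
  constructor
  · rintro ⟨h, hx, -⟩
    exact ⟨hx, (T.mem_cell_iff hx (by simp)).2 h⟩
  · rintro ⟨hx, h⟩
    have h' := (T.mem_cell_iff hx (length_pre d n)).1 h
    exact ⟨h', hx, (T.mem_cell_iff hx (by simp)).2 (pre_eq_of_le h' hmn)⟩

lemma cellLaw_cylinder_of_ne {w : List 𝒳} {d : ℕ → 𝒳} {m n : ℕ} (hw : w.length = m) (hmn : m ≤ n)
    (h : pre d m ≠ w) : T.cellLaw w {d' | pre d' n = pre d n} = 0 := by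
  rw [cellLaw, Measure.map_apply T.measurable_digits (measurableSet_pre n fun w => w = pre d n),
    Measure.restrict_apply (T.measurable_digits (measurableSet_pre n fun w => w = pre d n))]
  convert! measure_empty (μ := (volume : Measure ℝ))
  rw [eq_empty_iff_forall_notMem]
  rintro x ⟨h1, hx, h2⟩
  simp only [mem_preimage, mem_ofPred_eq] at h1
  rw [T.mem_cell_iff hx hw] at h2
  exact h (pre_eq_of_le h1 hmn ▸ h2)

lemma cellLaw_compl_digitRange (w : List 𝒳) : T.cellLaw w T.digitRangeᶜ = 0 := by
  rw [cellLaw, Measure.map_apply T.measurable_digits T.measurableSet_digitRange.compl,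
    Measure.restrict_apply (T.measurable_digits T.measurableSet_digitRange.compl)]
  convert! measure_empty (μ := (volume : Measure ℝ))
  rw [eq_empty_iff_forall_notMem]
  rintro x ⟨h1, hx, -⟩
  exact h1 ⟨x, hx, rfl⟩

lemma cellLaw_map_point (w : List 𝒳) : (T.cellLaw w).map T.point = volume.restrict (T.J ∩ T.cell w) := by
  rw [cellLaw, Measure.map_map T.measurable_point T.measurable_digits]
  conv_rhs => rw [← Measure.map_id (μ := volume.restrict (T.J ∩ T.cell w))]
  refine Measure.map_congr ?_
  filter_upwards [ae_restrict_mem (T.measurableSet_J.inter (T.measurableSet_cell w))] with x hx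
  exact T.point_digits hx.1

omit [Countable 𝒳] [Nonempty 𝒳] [DiscreteMeasurableSpace 𝒳] in
lemma measurable_shift (n : ℕ) : Measurable fun (d : ℕ → 𝒳) i => d (n + i) :=
  measurable_pi_iff.2 fun _ => measurable_pi_apply _

lemma pre_shift (d : ℕ → 𝒳) (n m : ℕ) : pre (fun i => d (n + i)) m = window d n m := rfl

/-- Shifting the digits of a uniform point of the interval with digits `(u, z)` gives the digits of
a uniform point of the interval with digits `z`. -/
lemma IsMarkov.cellLaw_map_shift (hM : T.IsMarkov s) (u : List 𝒳) {z : List 𝒳} (hz : z.length = s)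
    (hpos : 0 < T.len z) : (T.cellLaw (u ++ z)).map (fun d i => d (u.length + i)) =
      ENNReal.ofReal (T.len (u ++ z) / T.len z) • T.cellLaw z := by
  refine measure_eq_of_cylinders s fun d n hn => ?_
  have hmeas := measurableSet_pre n fun w => w = pre d n
  rw [Measure.map_apply (measurable_shift _) hmeas, Measure.smul_apply, smul_eq_mul]
  -- A cylinder of length at least s either prescribes `z`, and lengths factorize, or excludes it,
  -- and both sides vanish.
  by_cases hd : pre d s = z
  · rw [← hd, cellLaw_cylinder hn, hd, ← T.ofReal_len,
      ← ENNReal.ofReal_mul (div_nonneg (T.len_nonneg _) (T.len_nonneg _))]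
    obtain ⟨j, rfl⟩ := Nat.exists_eq_add_of_le hn
    have h1 : T.len (u ++ z) / T.len z * T.len (pre d (s + j)) = T.len (u ++ pre d (s + j)) := by
      rw [pre_add, hd, ← List.append_assoc, div_mul_eq_mul_div, ← hM.len_mul_len u hz]
      field_simp
    rw [h1, T.ofReal_len]
    -- Among sequences that start with `u`, the preimage of the cylinder under the shift is again a
    -- cylinder, namely that of `e`.
    obtain ⟨e, he⟩ := exists_pre_eq (u ++ pre d (s + j))
    rw [show (u ++ pre d (s + j)).length = u.length + (s + j) by simp] at he
    have he1 : pre e (u.length + s) = u ++ z := by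
      rw [← add_assoc, pre_add, ] at he
      rw [pre_add d, ← List.append_assoc, hd] at he
      exact (List.append_inj he (by simp [hz])).1
    have he2 : pre e u.length = u ∧ window e u.length (s + j) = pre d (s + j) := by
      rw [pre_add] at he
      exact List.append_inj he (by simp)
    rw [← he, ← cellLaw_cylinder (m := u.length + s) (by omega), he1]
    refine measure_congr ?_
    have h0 : ∀ᵐ d' ∂(T.cellLaw (u ++ z)), pre d' (u.length + s) = u ++ z := by
      rw [cellLaw, ae_map_iff T.measurable_digits.aemeasurable
        (measurableSet_pre _ fun w => w = u ++ z)]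
      filter_upwards [ae_restrict_mem (T.measurableSet_J.inter (T.measurableSet_cell _))] with x hx
      exact (T.mem_cell_iff hx.1 (by simp [hz])).1 hx.2
    filter_upwards [h0] with d' hd'
    refine propext ?_
    show pre (fun i => d' (u.length + i)) (s + j) = pre d (s + j) ↔
      pre d' (u.length + (s + j)) = pre e (u.length + (s + j))
    rw [pre_shift, pre_add d', pre_add e, he2.2]
    have h3 : pre d' u.length = pre e u.length := by
      rw [← he1] at hd'
      exact pre_eq_of_le hd' (by omega)
    rw [h3]
    simp
  · rw [cellLaw_cylinder_of_ne hz hn hd, mul_zero, cellLaw,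
      Measure.map_apply T.measurable_digits (measurable_shift _ hmeas),
      Measure.restrict_apply (T.measurable_digits (measurable_shift _ hmeas))]
    convert! measure_empty (μ := (volume : Measure ℝ))
    rw [eq_empty_iff_forall_notMem]
    rintro x ⟨h1, hx, h2⟩
    rw [T.mem_cell_iff hx (n := u.length + s) (by simp [hz]), pre_add] at h2
    have h3 : pre (fun i => T.digits x (u.length + i)) n = pre d n := h1
    have h4 := pre_eq_of_le h3 hn
    rw [pre_shift] at h4
    exact hd (h4 ▸ (List.append_inj h2 (by simp)).2)

/-- The digits of almost every point, after any time, are the digits of a point. -/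
lemma IsMarkov.ae_shift_mem_digitRange (hM : T.IsMarkov s) (n : ℕ) :
    ∀ᵐ x ∂(volume.restrict T.J), (fun i => T.digits x (n + i)) ∈ T.digitRange := by
  -- With n + s digits fixed, s known digits remain after the shift, as `cellLaw_map_shift` needs.
  have hcov : T.J ⊆ ⋃ w : {w : List 𝒳 // w.length = n + s ∧ 0 < T.len w}, T.J ∩ T.cell w.1 := by
    intro x hx
    have h := T.isDigits_digits hx (n + s)
    exact mem_iUnion.2 ⟨⟨_, by simp, T.len_pos_of_nonempty ⟨x, h⟩⟩, hx, h⟩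
  refine ae_restrict_of_ae_restrict_of_subset hcov ?_
  rw [ae_restrict_iUnion_iff]
  rintro ⟨w, hw, hpos⟩
  have hsplit : w = w.take n ++ w.drop n := (List.take_append_drop n w).symm
  have hz : (w.drop n).length = s := by simp [hw]
  have hu : (w.take n).length = n := by simp [hw]
  have hz0 : 0 < T.len (w.drop n) := hM.len_pos_of_append hz (hsplit ▸ hpos)
  have h := hM.cellLaw_map_shift (w.take n) hz hz0
  rw [← hsplit, hu] at h
  have h2 : ∀ᵐ d ∂((T.cellLaw w).map fun d i => d (n + i)), d ∈ T.digitRange := by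
    rw [h]
    refine Measure.ae_smul_measure ?_ _
    exact T.cellLaw_compl_digitRange _
  exact ae_of_ae_map T.measurable_digits.aemeasurable
    (ae_of_ae_map (measurable_shift n).aemeasurable h2)

end NestedSubdivision

instance : IsProbabilityMeasure unif01 := ⟨by simp [unif01]⟩

/-- The law of a sequence of i.i.d. uniform random variables. -/
noncomputable def unifSeq : Measure (ℕ → ℝ) := Measure.infinitePi fun _ => unif01

instance : IsProbabilityMeasure unifSeq := by unfold unifSeq; infer_instance

/-! ### Generating digits from innovations -/

section Extension

variable {𝒳 : Type*}

/-- The finite digit sequences generated from the initial digits `w` by the innovations `V`. -/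
def extList (s : ℕ) (g : List 𝒳 → ℝ → 𝒳) (w : List 𝒳) (V : ℕ → ℝ) : ℕ → List 𝒳
  | 0 => w
  | i + 1 => extList s g w V i ++
      [g ((extList s g w V i).drop ((extList s g w V i).length - s)) (V i)]

/-- The infinite digit sequence generated from the initial digits `w` by the innovations `V`. -/
noncomputable def extSeq [Nonempty 𝒳] (s : ℕ) (g : List 𝒳 → ℝ → 𝒳) (w : List 𝒳) (V : ℕ → ℝ) :
    ℕ → 𝒳 := fun i => (extList s g w V (i + 1)).getD i (Classical.arbitrary 𝒳)

variable {s : ℕ} {g : List 𝒳 → ℝ → 𝒳} {w : List 𝒳} {V : ℕ → ℝ}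

@[simp] lemma length_extList (i : ℕ) : (extList s g w V i).length = w.length + i := by
  induction i with
  | zero => rfl
  | succ i ih => simp [extList, ih, add_assoc]

lemma take_extList (i j : ℕ) :
    (extList s g w V (i + j)).take (w.length + i) = extList s g w V i := by
  induction j with
  | zero => simp [List.take_of_length_le]
  | succ j ih =>
    rw [← add_assoc, extList, List.take_append_of_le_length (by simp), ih]

variable [Nonempty 𝒳]

lemma pre_extSeq_eq_take (n : ℕ) :
    pre (extSeq s g w V) n = (extList s g w V n).take n := by
  induction n with
  | zero => simp
  | succ n ih =>
    have h : n < (extList s g w V (n + 1)).length := by simp; omega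
    rw [pre_succ, ih, extSeq, List.getD_eq_getElem _ _ h]
    have h2 : (extList s g w V (n + 1)).take n = (extList s g w V n).take n := by
      rw [extList, List.take_append_of_le_length (by simp)]
    rw [← h2, List.take_append_getElem h]

lemma pre_extSeq (i : ℕ) : pre (extSeq s g w V) (w.length + i) = extList s g w V i := by
  rw [pre_extSeq_eq_take, add_comm, ← take_extList i w.length, add_comm w.length i]

lemma pre_extSeq_length : pre (extSeq s g w V) w.length = w := pre_extSeq (g := g) 0

lemma extSeq_apply (hw : s ≤ w.length) (i : ℕ) : extSeq s g w V (w.length + i) =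
    g (window (extSeq s g w V) (w.length + i - s) s) (V i) := by
  have h := pre_extSeq (s := s) (g := g) (w := w) (V := V) (i + 1)
  rw [← add_assoc, pre_succ, extList, ← pre_extSeq] at h
  have h2 := (List.append_inj' h rfl).2
  rw [List.cons.injEq] at h2
  rw [h2.1, length_pre]
  congr 1
  obtain ⟨m, hm⟩ := Nat.exists_eq_add_of_le (show s ≤ w.length + i by omega)
  rw [hm, Nat.add_sub_cancel_left, add_comm, drop_pre]

/-- As long as the generated digits follow `d`, the state at each step is read off from `d`. Each
step then constrains a single innovation, so the event is a box. -/
lemma setOf_pre_extSeq {d : ℕ → 𝒳} (hw : s ≤ w.length) (hd : pre d w.length = w) (i : ℕ) :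
    {V | pre (extSeq s g w V) (w.length + i) = pre d (w.length + i)} =
      Set.pi (Finset.range i)
        fun j => {v | g (window d (w.length + j - s) s) v = d (w.length + j)} := by
  induction i with
  | zero => simp [pre_extSeq_length, hd]
  | succ i ih =>
    ext V
    have h1 : V ∈ Set.pi (Finset.range (i + 1) : Set ℕ)
        (fun j => {v | g (window d (w.length + j - s) s) v = d (w.length + j)}) ↔
        pre (extSeq s g w V) (w.length + i) = pre d (w.length + i) ∧
          g (window d (w.length + i - s) s) (V i) = d (w.length + i) := by
      have h2 : pre (extSeq s g w V) (w.length + i) = pre d (w.length + i) ↔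
        V ∈ Set.pi (Finset.range i : Set ℕ)
        (fun j => {v | g (window d (w.length + j - s) s) v = d (w.length + j)}) := by
        rw [← ih]; rfl
      rw [h2]
      simp only [Set.mem_pi, Finset.coe_range, mem_Iio, mem_ofPred_eq, Nat.lt_succ_iff_lt_or_eq]
      constructor
      · exact fun h => ⟨fun j hj => h j (Or.inl hj), h i (Or.inr rfl)⟩
      · rintro ⟨h, h'⟩ j (hj | rfl)
        · exact h j hj
        · exact h'
    rw [h1, mem_ofPred_eq, ← add_assoc, pre_succ, pre_succ]
    constructor
    · intro h
      obtain ⟨h2, h3⟩ := List.append_inj' h rfl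
      refine ⟨h2, ?_⟩
      rw [List.cons.injEq] at h3
      rw [← h3.1, extSeq_apply hw]
      congr 1
      obtain ⟨m, hm⟩ := Nat.exists_eq_add_of_le (show s ≤ w.length + i by omega)
      rw [hm, Nat.add_sub_cancel_left, ← drop_pre, ← drop_pre, add_comm m, ← hm, h2]
    · rintro ⟨h2, h3⟩
      rw [h2, ← h3, extSeq_apply hw]
      congr 3
      obtain ⟨m, hm⟩ := Nat.exists_eq_add_of_le (show s ≤ w.length + i by omega)
      rw [hm, Nat.add_sub_cancel_left, ← drop_pre, ← drop_pre, add_comm m, ← hm, h2]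

variable [Countable 𝒳] [MeasurableSpace 𝒳] [DiscreteMeasurableSpace 𝒳]

lemma measurable_extSeq (hg : ∀ z k, MeasurableSet {v : ℝ | g z v = k}) (w : List 𝒳) :
    Measurable (extSeq s g w) := by
  have h : ∀ i l, MeasurableSet {V | extList s g w V i = l} := by
    intro i
    induction i with
    | zero => exact fun l => .const (w = l)
    | succ i ih =>
      intro l
      have h2 : {V | extList s g w V (i + 1) = l} = ⋃ p ∈ {p : List 𝒳 × 𝒳 | p.1 ++ [p.2] = l},
          {V | extList s g w V i = p.1} ∩
            (fun V => V i) ⁻¹' {v | g (p.1.drop (p.1.length - s)) v = p.2} := by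
        ext V
        simp only [extList, mem_ofPred_eq, mem_iUnion, mem_inter_iff, mem_preimage]
        constructor
        · exact fun h => ⟨(_, _), h, rfl, rfl⟩
        · rintro ⟨⟨l', k⟩, rfl, rfl, h⟩
          simp only at h
          rw [h]
      rw [h2]
      exact MeasurableSet.biUnion (to_countable _) fun p _ =>
        (ih _).inter (measurable_pi_apply i (hg _ _))
  rw [measurable_pi_iff]
  intro i
  refine measurable_to_countable' fun k => ?_
  have h2 : (fun V => extSeq s g w V i) ⁻¹' {k} = ⋃ l ∈ {l : List 𝒳 |
      l.getD i (Classical.arbitrary 𝒳) = k}, {V | extList s g w V (i + 1) = l} := by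
    ext V
    simp [extSeq]
  rw [h2]
  exact MeasurableSet.biUnion (to_countable _) fun _ _ => h _ _

lemma measurable_extSeq_comp (hg : ∀ z k, MeasurableSet {v : ℝ | g z v = k}) {α : Type*}
    [MeasurableSpace α] {W : α → List 𝒳} (hW : ∀ l, MeasurableSet {a | W a = l})
    {U : α → ℕ → ℝ} (hU : Measurable U) : Measurable fun a => extSeq s g (W a) (U a) := by
  let _ : MeasurableSpace (List 𝒳) := ⊤
  have h1 : Measurable fun p : List 𝒳 × (ℕ → ℝ) => extSeq s g p.1 p.2 :=
    measurable_from_prod_countable_right fun l => measurable_extSeq hg l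
  have h2 : Measurable W := measurable_to_countable' hW
  exact h1.comp (h2.prodMk hU)

end Extension

/-! ### Law of the generated digits -/

namespace NestedSubdivision

variable {𝒳 : Type*} [Countable 𝒳] [Nonempty 𝒳] [MeasurableSpace 𝒳] [DiscreteMeasurableSpace 𝒳]
  {T : NestedSubdivision 𝒳} {s : ℕ} {g : List 𝒳 → ℝ → 𝒳}

lemma IsMarkov.len_window_pos (hM : T.IsMarkov s) {d : ℕ → 𝒳} {n : ℕ}
    (h : 0 < T.len (pre d (n + s))) : 0 < T.len (window d n s) :=
  hM.len_pos_of_append (u := pre d n) (by simp) (by rwa [← pre_add])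

/-- The box has as probability a product of ratios, which telescopes to a quotient of lengths. -/
lemma unifSeq_pre_extSeq (hM : T.IsMarkov s) (hg : T.IsUpdate s g) {w : List 𝒳}
    (hw : s ≤ w.length) {d : ℕ → 𝒳} (hd : pre d w.length = w) (i : ℕ) :
    unifSeq {V | pre (extSeq s g w V) (w.length + i) = pre d (w.length + i)} *
      volume (T.cell w) = volume (T.cell (pre d (w.length + i))) := by
  have hbox : ∀ i, unifSeq {V | pre (extSeq s g w V) (w.length + i) = pre d (w.length + i)} =
      ∏ j ∈ Finset.range i,
        unif01 {v | g (window d (w.length + j - s) s) v = d (w.length + j)} := by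
    intro i
    rw [setOf_pre_extSeq hw hd, unifSeq, Measure.infinitePi_pi]
    exact fun j _ => hg.measurable _ _
  rw [hbox]
  induction i with
  | zero => simp [hd]
  | succ i ih =>
    rw [Finset.prod_range_succ, mul_right_comm, ih, ← add_assoc, pre_succ, ← T.ofReal_len,
      ← T.ofReal_len]
    rcases (T.len_nonneg (pre d (w.length + i))).eq_or_lt with h0 | hpos
    · have h1 : T.len (pre d (w.length + i) ++ [d (w.length + i)]) = 0 :=
        le_antisymm (h0 ▸ T.len_append_le _ _) (T.len_nonneg _)
      rw [h1, ← h0]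
      simp
    · obtain ⟨m, hm⟩ := Nat.exists_eq_add_of_le (show s ≤ w.length + i by omega)
      rw [add_comm s m] at hm
      have hwin : 0 < T.len (window d m s) := hM.len_window_pos (hm ▸ hpos)
      have h2 := hg.law_eq ⟨window d m s, by simp, hwin⟩ (d (w.length + i))
      rw [hM.len_append_singleton (by simp; omega) hpos, ENNReal.ofReal_mul (T.len_nonneg _),
        length_pre, Nat.sub_eq_of_eq_add hm]
      have h3 : (pre d (w.length + i)).drop m = window d m s := by rw [hm, drop_pre]
      rw [h3, ← h2]

/-- The digits that are generated from the initial digits `w` are the digits of a uniform point of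
the interval with digits `w`. -/
lemma unifSeq_map_extSeq (hM : T.IsMarkov s) (hg : T.IsUpdate s g) {w : List 𝒳}
    (hw : s ≤ w.length) (hpos : 0 < T.len w) :
    unifSeq.map (extSeq s g w) = (volume (T.cell w))⁻¹ • T.cellLaw w := by
  have h0 : volume (T.cell w) ≠ 0 := by rw [← T.ofReal_len]; simpa using hpos
  have : IsFiniteMeasure (unifSeq.map (extSeq s g w)) := by infer_instance
  refine measure_eq_of_cylinders w.length fun d n hn => ?_
  have hmeas := measurableSet_pre n fun w => w = pre d n
  rw [Measure.map_apply (measurable_extSeq hg.measurable w) hmeas, Measure.smul_apply, smul_eq_mul]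
  by_cases hd : pre d w.length = w
  · obtain ⟨i, rfl⟩ := Nat.exists_eq_add_of_le hn
    have h1 := unifSeq_pre_extSeq hM hg hw hd i
    have h2 := cellLaw_cylinder (T := T) (d := d) hn
    rw [hd] at h2
    rw [h2, ← h1, mul_comm, mul_assoc, ENNReal.mul_inv_cancel h0 (T.volume_cell_ne_top w), mul_one]
    rfl
  · rw [cellLaw_cylinder_of_ne rfl hn hd, mul_zero]
    convert! measure_empty (μ := unifSeq)
    rw [eq_empty_iff_forall_notMem]
    intro V hV
    have h1 := pre_eq_of_le hV hn
    rw [pre_extSeq_length] at h1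
    exact hd h1.symm

lemma unifSeq_point_extSeq (hM : T.IsMarkov s) (hg : T.IsUpdate s g) {w : List 𝒳}
    (hw : s ≤ w.length) (hpos : 0 < T.len w) {A : Set ℝ} (hA : MeasurableSet A) :
    unifSeq {V | T.point (extSeq s g w V) ∈ A} =
      (volume (T.cell w))⁻¹ * volume (A ∩ (T.J ∩ T.cell w)) := by
  have h := congrArg (fun μ => μ.map T.point A) (unifSeq_map_extSeq hM hg hw hpos)
  simp only [Measure.map_smul, cellLaw_map_point, Measure.smul_apply, smul_eq_mul] at h
  rw [Measure.map_map T.measurable_point (measurable_extSeq hg.measurable w),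
    Measure.map_apply (T.measurable_point.comp (measurable_extSeq hg.measurable w)) hA,
    Measure.restrict_apply hA] at h
  exact h

lemma ae_extSeq_mem_digitRange (hM : T.IsMarkov s) (hg : T.IsUpdate s g) {w : List 𝒳}
    (hw : s ≤ w.length) (hpos : 0 < T.len w) : ∀ᵐ V ∂unifSeq, extSeq s g w V ∈ T.digitRange := by
  have h1 : ∀ᵐ d ∂(unifSeq.map (extSeq s g w)), d ∈ T.digitRange := by
    rw [unifSeq_map_extSeq hM hg hw hpos]
    exact Measure.ae_smul_measure (T.cellLaw_compl_digitRange _) _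
  exact ae_of_ae_map (measurable_extSeq hg.measurable w).aemeasurable h1

end NestedSubdivision

/-- The sequence with first term `a` and remaining terms `d`. -/
def consSeq {𝒳 : Type*} (a : 𝒳) (d : ℕ → 𝒳) : ℕ → 𝒳
  | 0 => a
  | i + 1 => d i

lemma pre_consSeq {𝒳 : Type*} (a : 𝒳) (d : ℕ → 𝒳) (n : ℕ) :
    pre (consSeq a d) (n + 1) = a :: pre d n := by
  simp [pre, List.range_succ_eq_map, consSeq, Function.comp_def]

lemma take_pre {𝒳 : Type*} (d : ℕ → 𝒳) {n m : ℕ} (h : n ≤ m) : (pre d m).take n = pre d n := by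
  obtain ⟨k, rfl⟩ := Nat.exists_eq_add_of_le h
  rw [pre_add, List.take_left' (by simp)]

/-! ### Regenerating digits -/

namespace NestedSubdivision

variable {𝒳 : Type*} [Countable 𝒳] [Nonempty 𝒳] [MeasurableSpace 𝒳] [DiscreteMeasurableSpace 𝒳]
  {T : NestedSubdivision 𝒳} {s : ℕ} {g : List 𝒳 → ℝ → 𝒳}

lemma lintegral_J_eq_tsum (m : ℕ) (F : ℝ → ENNReal) :
    ∫⁻ x in T.J, F x = ∑' w : T.Adm m, ∫⁻ x in T.J ∩ T.cell w.1, F x := by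
  have hU : T.J = ⋃ w : T.Adm m, T.J ∩ T.cell w.1 := by
    ext x
    simp only [mem_iUnion, mem_inter_iff, exists_and_left, iff_self_and]
    intro hx
    have h := T.isDigits_digits hx m
    exact ⟨⟨_, by simp, T.len_pos_of_nonempty ⟨x, h⟩⟩, h⟩
  have hd : Pairwise (Function.onFun Disjoint fun w : T.Adm m => T.J ∩ T.cell w.1) := by
    intro v w hvw
    refine Set.disjoint_left.2 fun x hx hx' => hvw (Subtype.ext ?_)
    exact T.eq_of_mem_cell (v.2.1.trans w.2.1.symm) hx.2 hx'.2
  conv_lhs => rw [hU]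
  exact lintegral_iUnion (fun w => T.measurableSet_J.inter (T.measurableSet_cell _)) hd _

lemma setLIntegral_cell {m : ℕ} {w : List 𝒳} (hw : w.length = m) (F : List 𝒳 → ℝ → ENNReal) :
    ∫⁻ x in T.J ∩ T.cell w, F (pre (T.digits x) m) x = ∫⁻ x in T.J ∩ T.cell w, F w x := by
  refine setLIntegral_congr_fun (T.measurableSet_J.inter (T.measurableSet_cell w)) fun x hx => ?_
  simp only [(T.mem_cell_iff hx.1 hw).1 hx.2]

lemma volume_cell_ne_zero {w : List 𝒳} (h : 0 < T.len w) : volume (T.cell w) ≠ 0 := by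
  rw [← T.ofReal_len]; simpa using h

/-- If a density depends only on the first `m ≥ s` digits, then generating the digits after time
`m` anew does not change the distribution. -/
lemma lintegral_restart (hM : T.IsMarkov s) (hg : T.IsUpdate s g) {m : ℕ} (hm : s ≤ m)
    (φ : List 𝒳 → ENNReal) {A : Set ℝ} (hA : MeasurableSet A) :
    ∫⁻ x in T.J, φ (pre (T.digits x) m) *
      unifSeq {V | T.point (extSeq s g (pre (T.digits x) m) V) ∈ A} =
    ∫⁻ x in T.J, φ (pre (T.digits x) m) * A.indicator 1 x := by
  rw [lintegral_J_eq_tsum m, lintegral_J_eq_tsum m]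
  -- On each cell of level m the weight is constant and the regenerated point is uniform, so both
  -- integrals equal the weight times the volume of `A` in the cell.
  congr 1
  funext ⟨w, hw, hpos⟩
  rw [setLIntegral_cell hw fun w _ => φ w * unifSeq {V | T.point (extSeq s g w V) ∈ A},
    setLIntegral_cell hw fun w x => φ w * A.indicator 1 x, setLIntegral_const,
    unifSeq_point_extSeq hM hg (hw ▸ hm) hpos hA, T.volume_J_inter_cell,
    lintegral_const_mul _ (measurable_one.indicator hA), lintegral_indicator_one hA,
    Measure.restrict_apply hA, mul_assoc, mul_right_comm,
    ENNReal.inv_mul_cancel (volume_cell_ne_zero hpos) (T.volume_cell_ne_top w), one_mul]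

lemma map_digits_ae_pre {w : List 𝒳} {m : ℕ} (hw : w.length = m) :
    ∀ᵐ d ∂(T.cellLaw w), pre d m = w := by
  rw [cellLaw, ae_map_iff T.measurable_digits.aemeasurable (measurableSet_pre _ fun w' => w' = w)]
  filter_upwards [ae_restrict_mem (T.measurableSet_J.inter (T.measurableSet_cell _))] with x hx
  exact (T.mem_cell_iff hx.1 hw).1 hx.2

/-! ### Stationarity of the invariant distribution -/

section Invariant

variable {ϖ : T.Adm s → ℝ}

open Classical in
/-- The constant value on the interval with digits `w` of the density with the probabilities `ϖ`. -/
noncomputable def pmfWeight (s : ℕ) (ϖ : T.Adm s → ℝ) (w : List 𝒳) : ℝ :=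
  if h : w.length = s ∧ 0 < T.len w then ϖ ⟨w, h⟩ / T.len w else 0

lemma pmfDensity_eq (ϖ : T.Adm s → ℝ) (x : ℝ) :
    T.pmfDensity s ϖ x = pmfWeight s ϖ (pre (T.digits x) s) := rfl

lemma measurable_pmfDensity (ϖ : T.Adm s → ℝ) : Measurable (T.pmfDensity s ϖ) :=
  (measurable_comp_pre s (pmfWeight s ϖ)).comp T.measurable_digits

lemma law_pmfDensity_map_digits (ϖ : T.Adm s → ℝ) {A : Set (ℕ → 𝒳)} (hA : MeasurableSet A) :
    (T.law (T.pmfDensity s ϖ)).map T.digits A =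
      ∑' z : T.Adm s, ENNReal.ofReal (ϖ z / T.len z.1) * T.cellLaw z.1 A := by
  have hA' := T.measurable_digits hA
  rw [Measure.map_apply T.measurable_digits hA, law, withDensity_apply _ hA',
    ← lintegral_indicator hA', lintegral_J_eq_tsum s]
  congr 1
  funext ⟨z, hz, hpos⟩
  rw [lintegral_indicator hA']
  have h1 : ∀ᵐ x ∂(volume.restrict (T.J ∩ T.cell z)).restrict (T.digits ⁻¹' A),
      ENNReal.ofReal (T.pmfDensity s ϖ x) = ENNReal.ofReal (ϖ ⟨z, hz, hpos⟩ / T.len z) := by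
    refine ae_restrict_of_ae ?_
    filter_upwards [ae_restrict_mem (T.measurableSet_J.inter (T.measurableSet_cell z))] with x hx
    rw [pmfDensity_eq, (T.mem_cell_iff hx.1 hz).1 hx.2, pmfWeight, dif_pos ⟨hz, hpos⟩]
  rw [lintegral_congr_ae h1, setLIntegral_const, cellLaw, Measure.map_apply T.measurable_digits hA]

lemma IsInvariantPMF.isProbabilityMeasure (hϖ : T.IsInvariantPMF s ϖ) :
    IsProbabilityMeasure (T.law (T.pmfDensity s ϖ)) := by
  have h1 : (T.law (T.pmfDensity s ϖ)).map T.digits univ = 1 := by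
    rw [law_pmfDensity_map_digits ϖ .univ, ← ENNReal.ofReal_one, ← hϖ.hasSum_one.tsum_eq,
      ENNReal.ofReal_tsum_of_nonneg hϖ.nonneg hϖ.hasSum_one.summable]
    congr 1
    funext ⟨z, hz, hpos⟩
    rw [cellLaw, Measure.map_apply T.measurable_digits .univ, preimage_univ,
      Measure.restrict_apply_univ, T.volume_J_inter_cell, ← T.ofReal_len,
      ← ENNReal.ofReal_mul (div_nonneg (hϖ.nonneg _) (T.len_nonneg _))]
    congr 1
    have := hpos.ne'
    field_simp
  rw [Measure.map_apply T.measurable_digits .univ, preimage_univ] at h1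
  exact ⟨h1⟩

lemma cellLaw_shift_cylinder (hs : 1 ≤ s) {a : 𝒳} {u' : List 𝒳} (hu : (a :: u').length = s)
    (d : ℕ → 𝒳) (n : ℕ) :
    T.cellLaw (a :: u') {d' | window d' 1 n = pre d n} =
      T.cellLaw (a :: u') {d' | pre d' (n + 1) = pre (consSeq a d) (n + 1)} := by
  refine measure_congr ?_
  filter_upwards [map_digits_ae_pre hu] with d' hd'
  refine propext ?_
  show window d' 1 n = pre d n ↔ pre d' (n + 1) = pre (consSeq a d) (n + 1)
  have h0 : pre d' 1 = [a] := by
    rw [← take_pre d' hs, hd']; simp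
  rw [pre_consSeq, add_comm n 1, pre_add, h0]
  simp

/-- The digits of a point with the invariant density form a stationary sequence. -/
lemma IsInvariantPMF.map_shift_one (hM : T.IsMarkov s) (hs : 1 ≤ s) (hϖ : T.IsInvariantPMF s ϖ) :
    ((T.law (T.pmfDensity s ϖ)).map T.digits).map (fun d i => d (1 + i)) =
      (T.law (T.pmfDensity s ϖ)).map T.digits := by
  classical
  have := hϖ.isProbabilityMeasure
  refine measure_eq_of_cylinders s fun d n hn => ?_
  have hmeas := measurableSet_pre n fun w => w = pre d n
  rw [Measure.map_apply (measurable_shift _) hmeas,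
    law_pmfDensity_map_digits ϖ (measurable_shift _ hmeas), law_pmfDensity_map_digits ϖ hmeas]
  -- On the cell of `u`, the shifted cylinder is the cylinder of d₁, …, dₙ preceded by the first
  -- digit of `u`. It has positive measure only if the tail of `u` is d₁, …, dₛ₋₁.
  have hL : ∀ u : T.Adm s, T.cellLaw u.1 ((fun d i => d (1 + i)) ⁻¹' {d' | pre d' n = pre d n}) =
      ENNReal.ofReal (if (pre d s).take (s - 1) = u.1.drop 1 then
        T.len (u.1 ++ window d (s - 1) (n - (s - 1))) else 0) := by
    rintro ⟨u, hu, hpos⟩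
    obtain ⟨a, u', rfl⟩ : ∃ a u', u = a :: u' :=
      List.exists_cons_of_ne_nil (by rintro rfl; simp at hu; omega)
    have h1 := cellLaw_shift_cylinder (T := T) hs hu d n
    have h2 : pre (consSeq a d) s = a :: pre d (s - 1) := by
      obtain ⟨r, rfl⟩ := Nat.exists_eq_add_of_le' hs
      exact pre_consSeq a d r
    refine h1.trans ?_
    simp only
    rw [take_pre d (Nat.sub_le s 1), List.drop_one, List.tail_cons]
    split_ifs with h
    · rw [h] at h2
      rw [← h2, cellLaw_cylinder (by omega), T.ofReal_len, h2, ← h, pre_consSeq, List.cons_append,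
        ← pre_add, Nat.add_sub_cancel' (by omega)]
    · rw [ENNReal.ofReal_zero, cellLaw_cylinder_of_ne hu (by omega)]
      rw [h2]
      simpa using h
  have hR : ∀ u : T.Adm s, T.cellLaw u.1 {d' | pre d' n = pre d n} =
      if pre d s = u.1 then ENNReal.ofReal (T.len (pre d n)) else 0 := by
    rintro ⟨u, hu, hpos⟩
    simp only
    split_ifs with h
    · rw [← h, cellLaw_cylinder hn, T.ofReal_len]
    · rw [cellLaw_cylinder_of_ne hu hn h]
  simp_rw [hL, hR]
  have hsplit : pre d n = pre d s ++ window d s (n - s) := by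
    rw [← pre_add, Nat.add_sub_cancel' hn]
  have hsplit2 : ∀ u : List 𝒳, (pre d s).take (s - 1) = u.drop 1 → u.length = s →
      ∃ a, u ++ window d (s - 1) (n - (s - 1)) = [a] ++ pre d s ++ window d s (n - s) ∧
        u ++ (pre d s).drop (s - 1) = [a] ++ pre d s := by
    intro u h hu
    obtain ⟨a, u', rfl⟩ : ∃ a u', u = a :: u' :=
      List.exists_cons_of_ne_nil (by rintro rfl; simp at hu; omega)
    refine ⟨a, ?_, ?_⟩
    · rw [List.append_assoc, ← hsplit]
      rw [take_pre d (Nat.sub_le s 1), List.drop_one, List.tail_cons] at h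
      rw [← h, List.cons_append, ← pre_add, Nat.add_sub_cancel' (by omega)]
      rfl
    · rw [List.drop_one, List.tail_cons] at h
      rw [List.cons_append, ← h, List.take_append_drop]
      rfl
  -- For an admissible state d₁, …, dₛ, the factorization ℓ(a d₁…dₙ) = ℓ(a d₁…dₛ)ℓ(d₁…dₙ)/ℓ(d₁…dₛ)
  -- reduces the identity to the invariance equation at that state. Otherwise all terms vanish.
  by_cases hz : 0 < T.len (pre d s)
  · have hR2 : ∑' z : T.Adm s, ENNReal.ofReal (ϖ z / T.len z.1) *
        (if pre d s = z.1 then ENNReal.ofReal (T.len (pre d n)) else 0) =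
        ENNReal.ofReal (ϖ ⟨pre d s, by simp, hz⟩) *
          ENNReal.ofReal (T.len (pre d n) / T.len (pre d s)) := by
      rw [tsum_eq_single ⟨pre d s, by simp, hz⟩]
      · rw [if_pos rfl, ← ENNReal.ofReal_mul (div_nonneg (hϖ.nonneg _) (T.len_nonneg _)),
          ← ENNReal.ofReal_mul (hϖ.nonneg _)]
        congr 1
        ring
      · intro z hzne
        rw [if_neg, mul_zero]
        exact fun h => hzne (Subtype.ext h.symm)
    rw [hR2, ← (hϖ.invariant ⟨pre d s, by simp, hz⟩).tsum_eq, ENNReal.ofReal_tsum_of_nonneg,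
      ← ENNReal.tsum_mul_right]
    · congr 1
      funext u
      rw [← ENNReal.ofReal_mul (div_nonneg (hϖ.nonneg _) (T.len_nonneg _)),
        ← ENNReal.ofReal_mul' (div_nonneg (T.len_nonneg _) (T.len_nonneg _))]
      congr 1
      simp only [trans]
      split_ifs with h
      · obtain ⟨a, ha, ha'⟩ := hsplit2 u.1 h u.2.1
        have h3 := hM.len_mul_len [a] (z := pre d s) (by simp) (window d s (n - s))
        rw [ha, ha', hsplit]
        have hu0 := u.2.2.ne'
        have hz0 := hz.ne'
        field_simp
        rw [mul_assoc, h3, mul_assoc]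
      · simp
    · intro u
      refine mul_nonneg (hϖ.nonneg _) ?_
      unfold trans
      split_ifs
      · exact div_nonneg (T.len_nonneg _) (T.len_nonneg _)
      · exact le_rfl
    · exact (hϖ.invariant _).summable
  · have hz0 : T.len (pre d n) = 0 := by
      refine le_antisymm ?_ (T.len_nonneg _)
      rw [hsplit]
      exact (T.len_append_le _ _).trans (not_lt.1 hz)
    rw [hz0]
    simp only [ENNReal.ofReal_zero, ite_self, mul_zero, tsum_zero, ENNReal.tsum_eq_zero]
    intro u
    rw [mul_eq_zero]
    right
    split_ifs with h
    · obtain ⟨a, ha, -⟩ := hsplit2 u.1 h u.2.1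
      rw [ha, ENNReal.ofReal_eq_zero]
      refine (T.len_append_le _ _).trans ?_
      by_contra hc
      exact hz (hM.len_pos_of_append (by simp) (not_le.1 hc))
    · simp

lemma IsInvariantPMF.map_shift (hM : T.IsMarkov s) (hs : 1 ≤ s) (hϖ : T.IsInvariantPMF s ϖ)
    (n : ℕ) : ((T.law (T.pmfDensity s ϖ)).map T.digits).map (fun d i => d (n + i)) =
      (T.law (T.pmfDensity s ϖ)).map T.digits := by
  induction n with
  | zero => simp
  | succ n ih =>
    conv_rhs => rw [← hϖ.map_shift_one hM hs, ← ih]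
    rw [Measure.map_map (measurable_shift 1) (measurable_shift n)]
    simp only [Function.comp_def, add_assoc]

lemma law_absolutelyContinuous (f : ℝ → ℝ) : T.law f ≪ volume.restrict T.J :=
  withDensity_absolutelyContinuous _ _

lemma ae_law_mem_J (f : ℝ → ℝ) : ∀ᵐ x ∂T.law f, x ∈ T.J :=
  law_absolutelyContinuous f (ae_restrict_mem T.measurableSet_J)

lemma law_map_digits_map_point (f : ℝ → ℝ) : ((T.law f).map T.digits).map T.point = T.law f := by
  rw [Measure.map_map T.measurable_point T.measurable_digits]
  conv_rhs => rw [← Measure.map_id (μ := T.law f)]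
  refine Measure.map_congr ?_
  filter_upwards [ae_law_mem_J f] with x hx
  exact T.point_digits hx

/-- The invariant distribution is invariant under taking remainders. -/
lemma IsInvariantPMF.map_rem (hM : T.IsMarkov s) (hs : 1 ≤ s) (hϖ : T.IsInvariantPMF s ϖ)
    (n : ℕ) : (T.law (T.pmfDensity s ϖ)).map (T.rem n) = T.law (T.pmfDensity s ϖ) := by
  conv_rhs => rw [← law_map_digits_map_point, ← hϖ.map_shift hM hs n,
    Measure.map_map (measurable_shift n) T.measurable_digits,
    Measure.map_map T.measurable_point ((measurable_shift n).comp T.measurable_digits)]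
  rfl

end Invariant

end NestedSubdivision

/-! ### Sufficient digits: the decomposition of f -/

namespace NestedSubdivision

variable {𝒳 : Type*} [Countable 𝒳] [Nonempty 𝒳] [MeasurableSpace 𝒳] [DiscreteMeasurableSpace 𝒳]
  {T : NestedSubdivision 𝒳} {s : ℕ} {g : List 𝒳 → ℝ → 𝒳} {f : ℝ → ℝ} {H : Set ℝ}

lemma bddBelow_image (hf : ∀ x ∈ T.J, 0 ≤ f x) (hHJ : H ⊆ T.J) (w : List 𝒳) :
    BddBelow (f '' (H ∩ T.cell w)) :=
  ⟨0, by rintro _ ⟨x, hx, rfl⟩; exact hf x (hHJ hx.1)⟩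

lemma incr_pre_succ (d : ℕ → 𝒳) (n : ℕ) :
    T.incr f H (pre d (n + 1)) = T.infOn f H (pre d (n + 1)) - T.infOn f H (pre d n) := by
  rw [incr, if_neg (by simp [pre_succ]), pre_succ, List.dropLast_concat]

/-- A point of `H` keeps every set in the chain nonempty, so the infima increase. The default value
0 on an empty set could break this. -/
lemma incr_nonneg (hf : ∀ x ∈ T.J, 0 ≤ f x) (hHJ : H ⊆ T.J) {x : ℝ} (hx : x ∈ H) (n : ℕ) :
    0 ≤ T.incr f H (pre (T.digits x) n) := by
  cases n with
  | zero =>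
    rw [pre_zero]
    show 0 ≤ T.infOn f H []
    exact Real.sInf_nonneg (by rintro _ ⟨y, hy, rfl⟩; exact hf y (hHJ hy.1))
  | succ n =>
    rw [incr_pre_succ, sub_nonneg]
    refine csInf_le_csInf (bddBelow_image hf hHJ _)
      ⟨f x, x, ⟨hx, T.isDigits_digits (hHJ hx) _⟩, rfl⟩ ?_
    refine image_mono (inter_subset_inter_right _ ?_)
    rw [pre_succ]
    exact T.cell_append_subset _ _

lemma sum_incr (d : ℕ → 𝒳) (n : ℕ) :
    ∑ i ∈ Finset.range (n + 1), T.incr f H (pre d i) = T.infOn f H (pre d n) := by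
  induction n with
  | zero => simp [incr]
  | succ n ih => rw [Finset.sum_range_succ, ih, incr_pre_succ]; ring

/-- The infima stay below `f x` since `x` lies in each cell. They eventually exceed any smaller
value because the cells shrink into the neighbourhood supplied by lower semicontinuity. -/
lemma tendsto_infOn (hf : ∀ x ∈ T.J, 0 ≤ f x) (hHJ : H ⊆ T.J) (hLSC : LowerSemicontinuousOn f H)
    {x : ℝ} (hx : x ∈ H) :
    Tendsto (fun n => T.infOn f H (pre (T.digits x) n)) atTop (𝓝 (f x)) := by
  have hmem : ∀ n, x ∈ H ∩ T.cell (pre (T.digits x) n) :=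
    fun n => ⟨hx, T.isDigits_digits (hHJ hx) n⟩
  have hle : ∀ n, T.infOn f H (pre (T.digits x) n) ≤ f x :=
    fun n => csInf_le (bddBelow_image hf hHJ _) ⟨x, hmem n, rfl⟩
  refine tendsto_order.2 ⟨fun y hy => ?_, fun y hy => Eventually.of_forall fun n =>
    (hle n).trans_lt hy⟩
  -- Passing to the infimum loses strictness; the intermediate value restores it.
  obtain ⟨y', hyy', hy'⟩ := exists_between hy
  have h1 := hLSC x hx y' hy'
  rw [eventually_nhdsWithin_iff, Metric.eventually_nhds_iff] at h1
  obtain ⟨ε, hε, h1⟩ := h1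
  filter_upwards [(T.tendsto_len (T.digits x)).eventually_lt_const hε, eventually_ge_atTop 1]
    with n hn hn1
  refine hyy'.trans_le (le_csInf ⟨_, x, hmem n, rfl⟩ ?_)
  rintro _ ⟨z, hz, rfl⟩
  refine (h1 ?_ hz.1).le
  rw [Real.dist_eq]
  exact (T.dist_le_len (pre_ne_nil _ hn1) hz.2 (hmem n).2).trans_lt hn

lemma tsum_incr (hf : ∀ x ∈ T.J, 0 ≤ f x) (hHJ : H ⊆ T.J) (hLSC : LowerSemicontinuousOn f H)
    {x : ℝ} (hx : x ∈ H) :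
    ∑' n, ENNReal.ofReal (T.incr f H (pre (T.digits x) n)) = ENNReal.ofReal (f x) := by
  have h : HasSum (fun n => T.incr f H (pre (T.digits x) n)) (f x) := by
    rw [hasSum_iff_tendsto_nat_of_nonneg (incr_nonneg hf hHJ hx), ← tendsto_add_atTop_iff_nat 1]
    simp_rw [sum_incr]
    exact tendsto_infOn hf hHJ hLSC hx
  rw [← h.tsum_eq, ENNReal.ofReal_tsum_of_nonneg (incr_nonneg hf hHJ hx) h.summable]

lemma measurable_incr (f : ℝ → ℝ) (H : Set ℝ) : Measurable fun q : ℝ × ℕ =>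
    ENNReal.ofReal (T.incr f H (pre (T.digits q.1) q.2)) :=
  measurable_from_prod_countable_left fun n =>
    (measurable_comp_pre n fun w => ENNReal.ofReal (T.incr f H w)).comp T.measurable_digits

lemma lintegral_jointLaw (f : ℝ → ℝ) (H : Set ℝ) {F : ℝ × ℕ → ENNReal} (hF : Measurable F) :
    ∫⁻ q, F q ∂(T.jointLaw f H) =
      ∑' n, ∫⁻ x in H, ENNReal.ofReal (T.incr f H (pre (T.digits x) n)) * F (x, n) := by
  rw [jointLaw, lintegral_withDensity_eq_lintegral_mul _ (measurable_incr f H) hF,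
    lintegral_prod_symm' _ ((measurable_incr f H).mul hF), lintegral_count]
  rfl

lemma restrict_eq_restrict_J (hHJ : H ⊆ T.J) (hH0 : volume (T.J \ H) = 0) :
    (volume : Measure ℝ).restrict H = volume.restrict T.J :=
  Measure.restrict_congr_set (hHJ.eventuallyLE.antisymm (ae_le_set.2 hH0))

lemma ae_jointLaw_mem (f : ℝ → ℝ) (hH : MeasurableSet H) :
    ∀ᵐ q ∂(T.jointLaw f H), q.1 ∈ H := by
  refine withDensity_absolutelyContinuous _ _ ?_
  have h : (volume.restrict H).prod (Measure.count : Measure ℕ) (Hᶜ ×ˢ univ) = 0 := by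
    rw [Measure.prod_prod, Measure.restrict_apply hH.compl]
    simp
  convert! h using 1
  congr 1
  ext q
  simp

lemma jointLaw_map_fst (hf : T.IsPDF f) (hH : MeasurableSet H) (hHJ : H ⊆ T.J)
    (hH0 : volume (T.J \ H) = 0) (hLSC : LowerSemicontinuousOn f H) :
    (T.jointLaw f H).map Prod.fst = T.law f := by
  ext A hA
  rw [Measure.map_apply measurable_fst hA, ← lintegral_indicator_one (measurable_fst hA),
    lintegral_jointLaw _ _ (measurable_one.indicator (measurable_fst hA)), law,
    withDensity_apply _ hA, ← restrict_eq_restrict_J hHJ hH0, ← lintegral_indicator hA,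
    ← lintegral_tsum]
  · refine setLIntegral_congr_fun hH fun x hx => ?_
    by_cases hxA : x ∈ A
    · simp [hxA, indicator, tsum_incr hf.nonneg hHJ hLSC hx]
    · simp [hxA, indicator]
  · intro n
    refine (((measurable_comp_pre n fun w => ENNReal.ofReal (T.incr f H w)).comp
      T.measurable_digits).mul ?_).aemeasurable
    exact (measurable_one.indicator (measurable_fst hA)).comp measurable_prodMk_right

lemma isProbabilityMeasure_law (hf : T.IsPDF f) : IsProbabilityMeasure (T.law f) :=
  ⟨by rw [law, withDensity_apply _ .univ, Measure.restrict_univ, hf.lintegral_eq_one]⟩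

lemma isProbabilityMeasure_jointLaw (hf : T.IsPDF f) (hH : MeasurableSet H) (hHJ : H ⊆ T.J)
    (hH0 : volume (T.J \ H) = 0) (hLSC : LowerSemicontinuousOn f H) :
    IsProbabilityMeasure (T.jointLaw f H) := by
  have h := jointLaw_map_fst hf hH hHJ hH0 hLSC
  have := isProbabilityMeasure_law hf
  exact ⟨by rw [← preimage_univ (f := Prod.fst), ← Measure.map_apply measurable_fst .univ, h,
    measure_univ]⟩

/-! ### Restarting at time max n s -/

section Restart

/-- The initial digits of a point that are kept when the digits after time `max n s` are generated
anew. -/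
noncomputable def keptDigits (T : NestedSubdivision 𝒳) (s : ℕ) (x : ℝ) (n : ℕ) : List 𝒳 :=
  pre (T.digits x) (max n s)

/-- The point whose digits after time `max n s` are generated anew from the innovations `V`. -/
noncomputable def restart (T : NestedSubdivision 𝒳) (s : ℕ) (g : List 𝒳 → ℝ → 𝒳) (x : ℝ) (n : ℕ)
    (V : ℕ → ℝ) : ℝ := T.point (extSeq s g (keptDigits T s x n) V)

omit [Countable 𝒳] [MeasurableSpace 𝒳] [DiscreteMeasurableSpace 𝒳] in
@[simp] lemma length_keptDigits (x : ℝ) (n : ℕ) :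
    (keptDigits T s x n).length = max n s := length_pre _ _

lemma measurableSet_keptDigits (l : List 𝒳) :
    MeasurableSet {p : ℝ × ℕ | keptDigits T s p.1 p.2 = l} := by
  have h : Measurable fun p : ℝ × ℕ => keptDigits T s p.1 p.2 = l :=
    measurable_from_prod_countable_left fun n =>
      (measurable_comp_pre (max n s) fun w => w = l).comp T.measurable_digits
  exact measurableSet_setOfPred.2 h

lemma measurable_restart (hg : T.IsUpdate s g) :
    Measurable fun p : (ℝ × ℕ) × (ℕ → ℝ) => restart T s g p.1.1 p.1.2 p.2 :=
  T.measurable_point.comp (measurable_extSeq_comp hg.measurable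
    (fun l => measurable_fst (measurableSet_keptDigits l)) measurable_snd)

lemma ae_restart (hM : T.IsMarkov s) (hg : T.IsUpdate s g) {x : ℝ} (hx : x ∈ T.J) (n : ℕ) :
    ∀ᵐ V ∂unifSeq, extSeq s g (keptDigits T s x n) V ∈ T.digitRange :=
  ae_extSeq_mem_digitRange hM hg (by simp)
    (T.len_pos_of_nonempty ⟨x, T.isDigits_digits hx _⟩)

/-- At level n the density depends on the first n ≤ `max n s` digits only, so `lintegral_restart`
applies to each level separately. -/
lemma lintegral_jointLaw_restart (hM : T.IsMarkov s) (hg : T.IsUpdate s g) (hHJ : H ⊆ T.J)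
    (hH0 : volume (T.J \ H) = 0) {B : Set (ℝ × ℕ)} (hB : MeasurableSet B) :
    ∫⁻ q, unifSeq {V | (restart T s g q.1 q.2 V, q.2) ∈ B} ∂(T.jointLaw f H) = T.jointLaw f H B := by
  have hmeas : Measurable fun q : ℝ × ℕ => unifSeq {V | (restart T s g q.1 q.2 V, q.2) ∈ B} := by
    have h1 : Measurable fun p : (ℝ × ℕ) × (ℕ → ℝ) => (restart T s g p.1.1 p.1.2 p.2, p.1.2) :=
      (measurable_restart hg).prodMk (by fun_prop)
    exact measurable_measure_prodMk_left (h1 hB)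
  rw [lintegral_jointLaw f H hmeas, ← lintegral_indicator_one hB,
    lintegral_jointLaw f H (measurable_one.indicator hB)]
  congr 1
  funext n
  rw [restrict_eq_restrict_J hHJ hH0]
  have hBn : MeasurableSet {x | (x, n) ∈ B} := measurable_prodMk_right hB
  have h := lintegral_restart hM hg (le_max_right n s)
    (fun l => ENNReal.ofReal (T.incr f H (l.take n))) hBn
  simp only [take_pre _ (le_max_left n s)] at h
  refine h.trans ?_
  rfl

/-- The density depends on s ≤ `max n s` digits, so every `n` is allowed. This lets the stationary
point restart at the time dictated by N. -/
lemma lintegral_law_restart (hM : T.IsMarkov s) (hg : T.IsUpdate s g) (ϖ : T.Adm s → ℝ) (n : ℕ)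
    {A : Set ℝ} (hA : MeasurableSet A) :
    ∫⁻ x, unifSeq {V | restart T s g x n V ∈ A} ∂(T.law (T.pmfDensity s ϖ)) =
      T.law (T.pmfDensity s ϖ) A := by
  have hmeas : Measurable fun x : ℝ => unifSeq {V | restart T s g x n V ∈ A} := by
    have h0 : Measurable fun p : ℝ × (ℕ → ℝ) => (((p.1, n), p.2) : (ℝ × ℕ) × (ℕ → ℝ)) :=
      (measurable_fst.prodMk measurable_const).prodMk measurable_snd
    have h1 := (measurable_restart hg).comp h0
    simp only [Function.comp_def] at h1
    have h2 : MeasurableSet {p : ℝ × (ℕ → ℝ) | restart T s g p.1 n p.2 ∈ A} := h1 hA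
    exact measurable_measure_prodMk_left h2
  have hd : Measurable fun x => ENNReal.ofReal (T.pmfDensity s ϖ x) :=
    (measurable_pmfDensity ϖ).ennreal_ofReal
  rw [← lintegral_indicator_one hA, law, lintegral_withDensity_eq_lintegral_mul _ hd hmeas,
    lintegral_withDensity_eq_lintegral_mul _ hd (measurable_one.indicator hA)]
  have h := lintegral_restart hM hg (le_max_right n s)
    (fun l => ENNReal.ofReal (pmfWeight s ϖ (l.take s))) hA
  simp only [take_pre _ (le_max_right n s)] at h
  exact h

end Restart

end NestedSubdivision

/-! ### First and second success in a sequence of trials -/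

section Trials

/-- The number of the first success in a sequence of trials with numbers `1, 2, …` (`0` if there
is none). -/
noncomputable def firstTime (C : ℕ → Prop) : ℕ := sInf {i | 1 ≤ i ∧ C i}

lemma firstTime_eq_iff {C : ℕ → Prop} {a : ℕ} (ha : 1 ≤ a) :
    firstTime C = a ↔ C a ∧ ∀ i, 1 ≤ i → i < a → ¬ C i := by
  constructor
  · rintro rfl
    have hne : {i | 1 ≤ i ∧ C i}.Nonempty := Nat.nonempty_of_pos_sInf ha
    exact ⟨(Nat.sInf_mem hne).2, fun i hi hlt hC => Nat.notMem_of_lt_sInf hlt ⟨hi, hC⟩⟩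
  · rintro ⟨hC, h⟩
    refine le_antisymm (Nat.sInf_le ⟨ha, hC⟩) (le_csInf ⟨a, ha, hC⟩ fun i hi => ?_)
    by_contra hlt
    exact h i hi.1 (not_le.1 hlt) hi.2

lemma firstTime_eq_zero_iff {C : ℕ → Prop} : firstTime C = 0 ↔ ∀ i, 1 ≤ i → ¬ C i := by
  rw [firstTime, Nat.sInf_eq_zero]
  simp [eq_empty_iff_forall_notMem]

/-- The right side fixes the outcomes of finitely many trials, which makes the event a box for
independent trials. -/
lemma two_successes_iff {C : ℕ → Prop} {a c : ℕ} (ha : 1 ≤ a) (hc : 1 ≤ c) :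
    (firstTime C = a ∧ firstTime (fun j => C (a + j)) = c) ↔
      ∀ i, 1 ≤ i → i ≤ a + c → (C i ↔ i = a ∨ i = a + c) := by
  rw [firstTime_eq_iff ha, firstTime_eq_iff hc]
  constructor
  · rintro ⟨⟨h1, h2⟩, h3, h4⟩ i hi hi'
    constructor
    · intro hC
      by_contra hne
      rw [not_or] at hne
      rcases lt_or_gt_of_ne hne.1 with h | h
      · exact h2 i hi h hC
      · obtain ⟨j, rfl⟩ := Nat.exists_eq_add_of_lt h
        exact h4 (j + 1) (by omega) (by omega) (by rwa [← add_assoc])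
    · rintro (rfl | rfl) <;> assumption
  · intro h
    refine ⟨⟨(h a ha (by omega)).2 (Or.inl rfl), fun i hi hlt hC => ?_⟩,
      (h (a + c) (by omega) le_rfl).2 (Or.inr rfl), fun j hj hlt hC => ?_⟩
    · have := (h i hi (by omega)).1 hC
      omega
    · have := (h (a + j) (by omega) (by omega)).1 hC
      omega

lemma measurable_firstTime {α : Type*} [MeasurableSpace α] {C : α → ℕ → Prop}
    (hC : ∀ i, MeasurableSet {a | C a i}) : Measurable fun a => firstTime (C a) := by
  refine measurable_to_countable' fun n => ?_
  have hbox : ∀ p : ℕ → Prop, MeasurableSet {a | ∀ i, p i → ¬ C a i} := by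
    intro p
    have h : {a | ∀ i, p i → ¬ C a i} = ⋂ i ∈ {i | p i}, {a | C a i}ᶜ := by
      ext a; simp
    rw [h]
    exact MeasurableSet.biInter (to_countable _) fun i _ => (hC i).compl
  rcases Nat.eq_zero_or_pos n with rfl | hn
  · have h : (fun a => firstTime (C a)) ⁻¹' {0} = {a | ∀ i, 1 ≤ i → ¬ C a i} := by
      ext a
      exact firstTime_eq_zero_iff
    rw [h]
    exact hbox _
  · have h : (fun a => firstTime (C a)) ⁻¹' {n} =
        {a | C a n} ∩ {a | ∀ i, (1 ≤ i ∧ i < n) → ¬ C a i} := by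
      ext a
      simp only [mem_preimage, mem_singleton_iff, mem_inter_iff, mem_ofPred_eq, and_imp]
      exact firstTime_eq_iff hn
    rw [h]
    exact (hC n).inter (hbox _)

/-- The geometric distribution on `{1, 2, …}` with failure probability `q` and success
probability `p`. -/
noncomputable def geomLaw (p q : ENNReal) : Measure ℕ :=
  Measure.count.withDensity fun a => if a = 0 then 0 else q ^ (a - 1) * p

lemma geomLaw_singleton (p q : ENNReal) (a : ℕ) :
    geomLaw p q {a} = if a = 0 then 0 else q ^ (a - 1) * p := by
  rw [geomLaw, withDensity_apply _ (measurableSet_singleton a), lintegral_singleton]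
  simp

lemma isProbabilityMeasure_geomLaw {p q : ENNReal} (hp : p ≠ 0) (hpq : p + q = 1) :
    IsProbabilityMeasure (geomLaw p q) := by
  refine ⟨?_⟩
  rw [geomLaw, withDensity_apply _ .univ, Measure.restrict_univ, lintegral_count,
    tsum_eq_zero_add' ENNReal.summable]
  have hp1 : p ≠ ⊤ := by
    rintro rfl
    simp at hpq
  have hq1 : q ≠ ⊤ := by
    rintro rfl
    simp at hpq
  have h : 1 - q = p := by rw [← hpq, ENNReal.add_sub_cancel_right hq1]
  simp [ENNReal.tsum_mul_right, ENNReal.tsum_geometric, h, ENNReal.inv_mul_cancel hp hp1]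

end Trials

/-! ### Blocks of innovations -/

section Blocks

variable {b : ℕ}

lemma measurable_blockInput (i : ℕ) : Measurable fun V : ℕ → ℝ => blockInput b V i :=
  measurable_pi_iff.2 fun _ => measurable_pi_apply _

/-- Consecutive blocks of i.i.d. uniform random variables are i.i.d. -/
lemma unifSeq_map_blocks (hb : 1 ≤ b) : unifSeq.map (fun V i => blockInput b V (i + 1)) =
    Measure.infinitePi fun _ : ℕ => Measure.pi fun _ : Fin b => unif01 := by
  -- Distinct block entries use distinct coordinates, so reindexing gives an i.i.d. array, whose
  -- rows are then curried into blocks.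
  have hinj : Function.Injective fun p : ℕ × Fin b => p.1 * b + p.2 := by
    rintro ⟨i, j⟩ ⟨i', j'⟩ h
    have h : i * b + j = i' * b + j' := h
    have h1 : i = i' := by
      have := congrArg (· / b) h
      simpa [Nat.add_div_of_dvd_right (Dvd.intro_left i rfl), Nat.add_div_of_dvd_right
        (Dvd.intro_left i' rfl), Nat.mul_div_cancel _ hb, Nat.div_eq_of_lt j.2,
        Nat.div_eq_of_lt j'.2] using this
    subst h1
    simp only [add_right_inj] at h
    exact Prod.ext rfl (Fin.ext h)
  have h := Measure.map_infinitePi_infinitePi_of_inj (P := fun _ : ℕ => unif01) hinj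
  have h2 := congrArg (fun μ => μ.map (MeasurableEquiv.curry ℕ (Fin b) ℝ)) h
  rw [Measure.infinitePi_map_curry (fun (_ : ℕ) (_ : Fin b) => unif01),
    Measure.map_map (MeasurableEquiv.measurable _) (by fun_prop)] at h2
  simp_rw [Measure.infinitePi_eq_pi] at h2
  rw [← h2]
  congr 1

variable {S : Set (Fin b → ℝ)}

/-- The number of the first block in `S`. -/
noncomputable def firstBlock (S : Set (Fin b → ℝ)) (V : ℕ → ℝ) : ℕ :=
  firstTime fun i => blockInput b V i ∈ S

/-- The number of blocks from the first block in `S` to the second one. -/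
noncomputable def secondBlock (S : Set (Fin b → ℝ)) (V : ℕ → ℝ) : ℕ :=
  firstTime fun j => blockInput b V (firstBlock S V + j) ∈ S

lemma measurable_firstBlock (hS : MeasurableSet S) : Measurable (firstBlock S) :=
  measurable_firstTime fun i => measurable_blockInput i hS

lemma measurable_secondBlock (hS : MeasurableSet S) : Measurable (secondBlock S) := by
  refine measurable_firstTime fun j => ?_
  have h : Measurable fun p : ℕ × (ℕ → ℝ) => blockInput b p.2 (p.1 + j) :=
    measurable_from_prod_countable_right fun n => measurable_blockInput (n + j)
  exact (h.comp ((measurable_firstBlock hS).prodMk measurable_id)) hS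

lemma blocks_iff {V : ℕ → ℝ} {a c : ℕ} (ha : 1 ≤ a) (hc : 1 ≤ c) :
    (firstBlock S V = a ∧ secondBlock S V = c) ↔
      ∀ i, 1 ≤ i → i ≤ a + c → (blockInput b V i ∈ S ↔ i = a ∨ i = a + c) := by
  rw [← two_successes_iff ha hc]
  unfold secondBlock
  constructor
  · rintro ⟨h1, h2⟩
    exact ⟨h1, by rwa [h1] at h2⟩
  · rintro ⟨h1, h2⟩
    exact ⟨h1, by rw [show firstBlock S V = a from h1]; exact h2⟩

lemma unifSeq_blocks (hb : 1 ≤ b) (hS : MeasurableSet S) {a c : ℕ} (ha : 1 ≤ a) (hc : 1 ≤ c) :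
    unifSeq {V | firstBlock S V = a ∧ secondBlock S V = c} =
      geomLaw (Measure.pi (fun _ => unif01) S) (Measure.pi (fun _ => unif01) Sᶜ) {a} *
      geomLaw (Measure.pi (fun _ => unif01) S) (Measure.pi (fun _ => unif01) Sᶜ) {c} := by
  classical
  obtain ⟨a, rfl⟩ := Nat.exists_eq_add_of_le' ha
  obtain ⟨c, rfl⟩ := Nat.exists_eq_add_of_le' hc
  -- In zero-based numbering the two successes are at `a` and `a + 1 + c`.
  have h1 : {V | firstBlock S V = a + 1 ∧ secondBlock S V = c + 1} =
      (fun V i => blockInput b V (i + 1)) ⁻¹'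
        (Set.pi (Finset.range (a + 1 + (c + 1)))
          fun i => if i = a ∨ i = a + 1 + c then S else Sᶜ) := by
    ext V
    rw [mem_ofPred_eq, blocks_iff ha hc]
    simp only [mem_preimage, Set.mem_pi, Finset.coe_range, mem_Iio]
    constructor
    · intro h i hi
      have h2 := h (i + 1) (by omega) (by omega)
      split_ifs with h3
      · exact h2.2 (by omega)
      · exact fun h4 => h3 (by have := h2.1 h4; omega)
    · intro h i hi hi'
      obtain ⟨i, rfl⟩ := Nat.exists_eq_add_of_le' hi
      have h2 := h i (by omega)
      split_ifs at h2 with h3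
      · exact ⟨fun _ => by omega, fun _ => h2⟩
      · exact ⟨fun h4 => absurd h4 h2, fun h4 => absurd (by omega) h3⟩
  have hm : ∀ i ∈ Finset.range (a + 1 + (c + 1)),
      MeasurableSet (if i = a ∨ i = a + 1 + c then S else Sᶜ) := by
    intro i _
    split_ifs
    · exact hS
    · exact hS.compl
  have hmeas : Measurable fun (V : ℕ → ℝ) i => blockInput b V (i + 1) :=
    measurable_pi_iff.2 fun i => measurable_blockInput _
  rw [h1, ← Measure.map_apply hmeas, unifSeq_map_blocks hb, Measure.infinitePi_pi _ hm,
    Finset.prod_range_add, Finset.prod_range_succ, Finset.prod_range_succ,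
    geomLaw_singleton, geomLaw_singleton]
  · have e1 : ∀ i ∈ Finset.range a, (Measure.pi fun _ : Fin b => unif01)
        (if i = a ∨ i = a + 1 + c then S else Sᶜ) = Measure.pi (fun _ => unif01) Sᶜ := by
      intro i hi
      rw [Finset.mem_range] at hi
      rw [if_neg (by omega)]
    have e2 : ∀ i ∈ Finset.range c, (Measure.pi fun _ : Fin b => unif01)
        (if a + 1 + i = a ∨ a + 1 + i = a + 1 + c then S else Sᶜ) =
          Measure.pi (fun _ => unif01) Sᶜ := by
      intro i hi
      rw [Finset.mem_range] at hi
      rw [if_neg (by omega)]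
    rw [Finset.prod_congr rfl e1, Finset.prod_congr rfl e2]
    simp
  · exact MeasurableSet.pi (to_countable _) hm

/-- The numbers of trials until the first and between the first and the second success are
independent and geometrically distributed. -/
lemma unifSeq_map_firstBlock_secondBlock (hb : 1 ≤ b) (hS : MeasurableSet S)
    (hpos : Measure.pi (fun _ => unif01) S ≠ 0) :
    unifSeq.map (fun V => (firstBlock S V, secondBlock S V)) =
      (geomLaw (Measure.pi (fun _ => unif01) S) (Measure.pi (fun _ => unif01) Sᶜ)).prod
      (geomLaw (Measure.pi (fun _ => unif01) S) (Measure.pi (fun _ => unif01) Sᶜ)) := by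
  have hm : Measurable fun V => (firstBlock S V, secondBlock S V) :=
    (measurable_firstBlock hS).prodMk (measurable_secondBlock hS)
  have hG := isProbabilityMeasure_geomLaw hpos (prob_add_prob_compl hS)
  have : IsProbabilityMeasure (unifSeq.map fun V => (firstBlock S V, secondBlock S V)) :=
    Measure.isProbabilityMeasure_map hm.aemeasurable
  -- Equal total mass makes one inequality enough. Pairs with a zero coordinate have product mass
  -- zero, so the almost sure existence of two successes needs no separate proof.
  refine (Measure.eq_of_le_of_measure_univ_eq ?_ (by simp)).symm
  refine Measure.le_iff.2 fun A hA => ?_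
  rw [← Measure.tsum_indicator_apply_singleton _ A hA,
    ← Measure.tsum_indicator_apply_singleton _ A hA]
  refine ENNReal.tsum_le_tsum fun q => indicator_le_indicator ?_
  obtain ⟨a, c⟩ := q
  rw [← singleton_prod_singleton, Measure.prod_prod]
  by_cases h : 1 ≤ a ∧ 1 ≤ c
  · rw [← unifSeq_blocks hb hS h.1 h.2, singleton_prod_singleton,
      Measure.map_apply hm (measurableSet_singleton _)]
    refine measure_mono fun V hV => ?_
    simpa using hV
  · rw [geomLaw_singleton, geomLaw_singleton]
    have : a = 0 ∨ c = 0 := by omega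
    rcases this with rfl | rfl <;> simp

end Blocks

/-! ### Representing distributions by uniform variables -/

section Representation

open unitInterval

lemma unif01_map_projIcc :
    unif01.map (projIcc (0 : ℝ) 1 zero_le_one) = (volume : Measure I) := by
  have h1 : (unif01 : Measure ℝ) = (volume : Measure I).map Subtype.val := by
    rw [unif01, Measure.restrict_congr_set Ioo_ae_eq_Icc]
    exact (map_comap_subtype_coe measurableSet_Icc volume).symm
  rw [h1, Measure.map_map continuous_projIcc.measurable measurable_subtype_coe]
  convert! Measure.map_id
  funext x
  exact projIcc_val zero_le_one x

lemma exists_map_unif01_eq {E : Type*} [MeasurableSpace E] [StandardBorelSpace E] [Nonempty E]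
    (μ : Measure E) [IsProbabilityMeasure μ] : ∃ φ : ℝ → E, Measurable φ ∧ unif01.map φ = μ := by
  obtain ⟨φ, hφ, h⟩ := μ.exists_measurable_map_eq
  refine ⟨φ ∘ projIcc 0 1 zero_le_one, hφ.comp continuous_projIcc.measurable, ?_⟩
  rw [← Measure.map_map hφ continuous_projIcc.measurable, unif01_map_projIcc, h]

variable {𝒳 : Type*} [Countable 𝒳] [Nonempty 𝒳] [MeasurableSpace 𝒳] [DiscreteMeasurableSpace 𝒳]

/-- A distribution that gives mass at least `c` to a set `G` is a mixture with weights `c` and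
`1 - c` of a distribution on `G` and another one. -/
lemma exists_mixture (p : Measure 𝒳) [IsProbabilityMeasure p] (G : Set 𝒳) {c : ENNReal}
    (hc0 : c ≠ 0) (hc1 : c < 1) :
    ∃ q₁ q₂ : ℝ → 𝒳, Measurable q₁ ∧ Measurable q₂ ∧ (c ≤ p G → ∀ u, q₁ u ∈ G) ∧
      c • unif01.map q₁ + (1 - c) • unif01.map q₂ = p := by
  have hc' : 1 - c ≠ 0 := (tsub_pos_of_lt hc1).ne'
  have hct : 1 - c ≠ ⊤ := by finiteness
  by_cases hG : c ≤ p G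
  · have hG0 : p G ≠ 0 := (pos_iff_ne_zero.2 hc0 |>.trans_le hG).ne'
    have hGt : p G ≠ ⊤ := measure_ne_top _ _
    have hGm : MeasurableSet G := .of_discrete
    have hdiv : c / p G ≤ 1 := ENNReal.div_le_of_le_mul (by rwa [one_mul])
    -- `p₁` is `p` conditioned on `G`, and `p₂` is the normalized rest of `p` after removal of `c •
    -- p₁`; here `c ≤ p G` is needed.
    let p₁ : Measure 𝒳 := (p G)⁻¹ • p.restrict G
    let p₂ : Measure 𝒳 := (1 - c)⁻¹ • (p.restrict Gᶜ + (1 - c / p G) • p.restrict G)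
    have hp₁ : IsProbabilityMeasure p₁ := ⟨by
      simp [p₁, ENNReal.inv_mul_cancel hG0 hGt]⟩
    have hsum : p Gᶜ + (1 - c / p G) * p G = 1 - c := by
      rw [ENNReal.sub_mul (fun _ _ => hGt), one_mul, ENNReal.div_mul_cancel hG0 hGt]
      refine ENNReal.eq_sub_of_add_eq hc1.ne_top ?_
      rw [add_assoc, tsub_add_cancel_of_le hG, add_comm, prob_add_prob_compl hGm]
    have hp₂ : IsProbabilityMeasure p₂ := ⟨by
      simp only [p₂, Measure.smul_apply, Measure.add_apply, Measure.restrict_apply_univ, smul_eq_mul,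
        hsum, ENNReal.inv_mul_cancel hc' hct]⟩
    obtain ⟨q₁, hq₁, h₁⟩ := exists_map_unif01_eq p₁
    obtain ⟨q₂, hq₂, h₂⟩ := exists_map_unif01_eq p₂
    -- Membership in `G` is wanted for every `u`, not just almost every one, so values outside `G`
    -- are replaced by `a`.
    obtain ⟨a, ha⟩ := nonempty_of_measure_ne_zero hG0
    classical
    refine ⟨fun u => if q₁ u ∈ G then q₁ u else a, q₂, ?_, hq₂, ?_, ?_⟩
    · exact (measurable_of_countable fun k => if k ∈ G then k else a).comp hq₁
    · intro _ u
      simp only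
      split_ifs with h
      exacts [h, ha]
    · have hae : (fun u => if q₁ u ∈ G then q₁ u else a) =ᵐ[unif01] q₁ := by
        have h3 : ∀ᵐ k ∂p₁, k ∈ G := Measure.ae_smul_measure (ae_restrict_mem hGm) _
        rw [← h₁] at h3
        filter_upwards [ae_of_ae_map hq₁.aemeasurable h3] with u hu
        rw [if_pos hu]
      rw [Measure.map_congr hae, h₁, h₂, smul_smul, smul_smul, ENNReal.mul_inv_cancel hc' hct,
        one_smul, ← div_eq_mul_inv, add_comm, add_assoc, ← add_smul,
        tsub_add_cancel_of_le hdiv, one_smul, Measure.restrict_compl_add_restrict hGm]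
  · obtain ⟨q, hq, h⟩ := exists_map_unif01_eq p
    refine ⟨q, q, hq, hq, fun h => absurd h hG, ?_⟩
    rw [h, ← add_smul, add_tsub_cancel_of_le hc1.le, one_smul]

end Representation

namespace NestedSubdivision

variable {𝒳 : Type*} [Countable 𝒳] {T : NestedSubdivision 𝒳} {s : ℕ}

/-! ### The transition matrix and its powers -/

section Transition

lemma trans_nonneg (z u : T.Adm s) : 0 ≤ T.trans s z u := by
  unfold trans
  split_ifs
  · exact div_nonneg (T.len_nonneg _) (T.len_nonneg _)
  · exact le_rfl

open Classical in
-- Turns sums over target states into sums over appended digits; with values in `ENNReal` they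
-- interchange freely.
lemma ofReal_trans (hs : 1 ≤ s) (z u : T.Adm s) : ENNReal.ofReal (T.trans s z u) =
    ∑' k, if z.1.tail ++ [k] = u.1 then ENNReal.ofReal (T.ratio z.1 k) else 0 := by
  obtain ⟨z, hz, hz0⟩ := z
  obtain ⟨u, hu, hu0⟩ := u
  simp only [trans, List.drop_one]
  have hzt : z.tail.length = s - 1 := by simp [hz]
  split_ifs with h
  · obtain ⟨k, hk⟩ := List.length_eq_one_iff.1 (show (u.drop (s - 1)).length = 1 by simp [hu]; omega)
    have hu2 : u = z.tail ++ [k] := by rw [← h, ← hk, List.take_append_drop]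
    rw [hk, tsum_eq_single k, if_pos hu2.symm]
    · rfl
    · intro k' hk'
      rw [if_neg]
      rw [hu2]
      simpa using hk'
  · rw [ENNReal.ofReal_zero, eq_comm, ENNReal.tsum_eq_zero]
    intro k
    rw [if_neg]
    rintro rfl
    exact h (List.take_left' hzt)

open Classical in
lemma tsum_ofReal_trans_mul (hs : 1 ≤ s) (z : T.Adm s) (F : T.Adm s → ENNReal) :
    ∑' u, ENNReal.ofReal (T.trans s z u) * F u =
      ∑' k, ENNReal.ofReal (T.ratio z.1 k) * ∑' u : T.Adm s,
        if z.1.tail ++ [k] = u.1 then F u else 0 := by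
  simp_rw [ofReal_trans hs, ← ENNReal.tsum_mul_right, ← ENNReal.tsum_mul_left]
  rw [ENNReal.tsum_comm]
  congr! 4
  split_ifs <;> simp

open Classical in
lemma tsum_ite_append_le (z : T.Adm s) (k : 𝒳) {F : T.Adm s → ENNReal} {c : ENNReal}
    (h : ∀ u : T.Adm s, z.1.tail ++ [k] = u.1 → F u ≤ c) :
    (∑' u : T.Adm s, if z.1.tail ++ [k] = u.1 then F u else 0) ≤ c := by
  by_cases hu : ∃ u : T.Adm s, z.1.tail ++ [k] = u.1
  · obtain ⟨u, hu⟩ := hu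
    rw [tsum_eq_single u, if_pos hu]
    · exact h u hu
    · intro u' hu'
      rw [if_neg]
      exact fun h' => hu' (Subtype.ext (h'.symm.trans hu))
  · rw [ENNReal.tsum_eq_zero.2]
    · exact zero_le
    · intro u
      rw [if_neg]
      exact fun h' => hu ⟨u, h'⟩

/-- The inequality suffices later and avoids checking that digits of positive probability lead to
admissible states. -/
lemma tsum_ofReal_trans_le (hs : 1 ≤ s) (z : T.Adm s) :
    ∑' u, ENNReal.ofReal (T.trans s z u) ≤ 1 := by
  classical
  have h := tsum_ofReal_trans_mul hs z fun _ => 1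
  simp only [mul_one] at h
  rw [h]
  calc _ ≤ ∑' k, ENNReal.ofReal (T.ratio z.1 k) * 1 := by
        gcongr with k
        exact tsum_ite_append_le z k fun _ _ => le_rfl
    _ = 1 := by simp_rw [mul_one, tsum_ratio z.2.2]

lemma summable_of_tsum_ofReal_le {ι : Type*} {a : ι → ℝ} (ha : ∀ i, 0 ≤ a i)
    (h : ∑' i, ENNReal.ofReal (a i) ≤ 1) : Summable a := by
  have := ENNReal.summable_toReal (h.trans_lt ENNReal.one_lt_top).ne
  simpa [ENNReal.toReal_ofReal, ha] using this

lemma summable_trans (hs : 1 ≤ s) (z : T.Adm s) : Summable (T.trans s z) :=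
  summable_of_tsum_ofReal_le (trans_nonneg z) (tsum_ofReal_trans_le hs z)

lemma transPow_nonneg (i : ℕ) (z w : T.Adm s) : 0 ≤ T.transPow s i z w := by
  induction i generalizing z with
  | zero => unfold transPow; split_ifs <;> simp
  | succ i ih => exact tsum_nonneg fun u => mul_nonneg (trans_nonneg _ _) (ih u)

/-- The real series defining the power would be 0 by default if it diverged; the bound `h1` gives
summability. -/
lemma ofReal_transPow_succ (hs : 1 ≤ s) {i : ℕ} (h1 : ∀ z w : T.Adm s, T.transPow s i z w ≤ 1)
    (z w : T.Adm s) : ENNReal.ofReal (T.transPow s (i + 1) z w) =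
      ∑' u, ENNReal.ofReal (T.trans s z u) * ENNReal.ofReal (T.transPow s i u w) := by
  have hnn : ∀ u, 0 ≤ T.trans s z u * T.transPow s i u w :=
    fun u => mul_nonneg (trans_nonneg _ _) (transPow_nonneg _ _ _)
  have hsum : Summable fun u => T.trans s z u * T.transPow s i u w :=
    (summable_trans hs z).of_nonneg_of_le hnn
      fun u => mul_le_of_le_one_right (trans_nonneg _ _) (h1 u w)
  rw [transPow, ENNReal.ofReal_tsum_of_nonneg hnn hsum]
  simp_rw [ENNReal.ofReal_mul (trans_nonneg _ _)]

lemma tsum_ofReal_transPow_le (hs : 1 ≤ s) (i : ℕ) (z : T.Adm s) :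
    ∑' w, ENNReal.ofReal (T.transPow s i z w) ≤ 1 := by
  classical
  induction i generalizing z with
  | zero =>
    rw [tsum_eq_single z]
    · simp [transPow]
    · intro w hw
      simp [transPow, hw.symm]
  | succ i ih =>
    have h1 : ∀ z w : T.Adm s, T.transPow s i z w ≤ 1 := fun z w => by
      rw [← ENNReal.ofReal_le_one]
      exact (ENNReal.le_tsum w).trans (ih z)
    simp_rw [ofReal_transPow_succ hs h1]
    rw [ENNReal.tsum_comm]
    simp_rw [ENNReal.tsum_mul_left]
    calc _ ≤ ∑' u, ENNReal.ofReal (T.trans s z u) * 1 := by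
          gcongr with u
          exact ih u
      _ ≤ 1 := by simpa using tsum_ofReal_trans_le hs z

lemma transPow_le_one (hs : 1 ≤ s) (i : ℕ) (z w : T.Adm s) : T.transPow s i z w ≤ 1 := by
  rw [← ENNReal.ofReal_le_one]
  exact (ENNReal.le_tsum w).trans (tsum_ofReal_transPow_le hs i z)

lemma summable_transPow (hs : 1 ≤ s) (i : ℕ) (z : T.Adm s) : Summable (T.transPow s i z) :=
  summable_of_tsum_ofReal_le (transPow_nonneg i z) (tsum_ofReal_transPow_le hs i z)

/-- Uniform ergodicity gives a uniform lower bound for the probability of some state at all large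
times. -/
lemma IsUnifGeomErgodic.exists_transPow_ge (hs : 1 ≤ s) {ϖ : T.Adm s → ℝ}
    (hϖ : T.IsUnifGeomErgodic s ϖ) : ∃ w : T.Adm s, ∃ δ : ℝ, 0 < δ ∧
      ∀ᶠ i in atTop, ∀ z, δ ≤ T.transPow s i z w := by
  have hinv := hϖ.isInvariant
  obtain ⟨w, hw⟩ : ∃ w, ϖ w ≠ 0 := by
    by_contra! h
    have h1 := hinv.hasSum_one
    rw [show ϖ = fun _ => 0 from funext h] at h1
    exact zero_ne_one (hasSum_zero.unique h1)
  have hwpos : 0 < ϖ w := lt_of_le_of_ne (hinv.nonneg w) hw.symm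
  obtain ⟨α, β, hβ0, hβ1, hrate⟩ := hϖ.rate
  refine ⟨w, ϖ w / 2, by positivity, ?_⟩
  have hlim : Tendsto (fun i => α * β ^ i) atTop (𝓝 0) := by
    simpa using (tendsto_pow_atTop_nhds_zero_of_lt_one hβ0 hβ1).const_mul α
  -- Half the ℓ¹ distance is below ϖ(w)/4, so the entry at `w` differs from ϖ(w) by less than
  -- ϖ(w)/2.
  filter_upwards [hlim.eventually_lt_const (show 0 < ϖ w / 4 by positivity),
    eventually_ge_atTop 1] with i hi hi1 z
  have hsum : Summable fun w => |T.transPow s i z w - ϖ w| :=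
    ((summable_transPow hs i z).sub hinv.hasSum_one.summable).abs
  have h1 := hsum.le_tsum w fun _ _ => abs_nonneg _
  have h2 := hrate z i hi1
  have h3 := neg_abs_le (T.transPow s i z w - ϖ w)
  linarith

end Transition

/-! ### An updating function with coalescent blocks -/

section Update

variable [Nonempty 𝒳] [MeasurableSpace 𝒳] [DiscreteMeasurableSpace 𝒳]

/-- The distribution of the next digit in state `z`. -/
noncomputable def stepLaw (T : NestedSubdivision 𝒳) (z : List 𝒳) : Measure 𝒳 :=
  Measure.count.withDensity fun k => ENNReal.ofReal (T.ratio z k)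

lemma stepLaw_apply (z : List 𝒳) (G : Set 𝒳) :
    stepLaw T z G = ∑' k, G.indicator (fun k => ENNReal.ofReal (T.ratio z k)) k := by
  rw [stepLaw, withDensity_apply _ .of_discrete, ← lintegral_indicator .of_discrete,
    lintegral_count]

lemma stepLaw_singleton (z : List 𝒳) (k : 𝒳) : stepLaw T z {k} = ENNReal.ofReal (T.ratio z k) := by
  rw [stepLaw, withDensity_apply _ .of_discrete, lintegral_singleton]
  simp

lemma isProbabilityMeasure_stepLaw {z : List 𝒳} (hz : 0 < T.len z) :
    IsProbabilityMeasure (stepLaw T z) :=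
  ⟨by rw [stepLaw_apply, indicator_univ, tsum_ratio hz]⟩

/-- The digits that lead from `z` to a state from which `w` is reached in `i` steps with
probability at least `δ`. -/
def goodDigits (T : NestedSubdivision 𝒳) (s i : ℕ) (w : T.Adm s) (δ : ℝ) (z : List 𝒳) : Set 𝒳 :=
  {k | ∃ u : T.Adm s, z.tail ++ [k] = u.1 ∧ δ ≤ T.transPow s i u w}

/-- Condition on the next digit: good digits contribute at most their total probability, the others
at most δ/2. -/
lemma le_stepLaw_goodDigits (hs : 1 ≤ s) {i : ℕ} {z w : T.Adm s} {δ : ℝ} (hδ : 0 ≤ δ)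
    (h : δ ≤ T.transPow s (i + 1) z w) :
    ENNReal.ofReal (δ / 2) ≤ stepLaw T z.1 (goodDigits T s i w (δ / 2) z.1) := by
  classical
  have h1 := ENNReal.ofReal_le_ofReal h
  rw [ofReal_transPow_succ hs (transPow_le_one hs i), tsum_ofReal_trans_mul hs] at h1
  have h2 : ∀ k, ENNReal.ofReal (T.ratio z.1 k) * (∑' u : T.Adm s,
      if z.1.tail ++ [k] = u.1 then ENNReal.ofReal (T.transPow s i u w) else 0) ≤
      (goodDigits T s i w (δ / 2) z.1).indicator (fun k => ENNReal.ofReal (T.ratio z.1 k)) k +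
        ENNReal.ofReal (T.ratio z.1 k) * ENNReal.ofReal (δ / 2) := by
    intro k
    by_cases hk : k ∈ goodDigits T s i w (δ / 2) z.1
    · rw [indicator_of_mem hk]
      refine le_add_right ?_
      calc _ ≤ ENNReal.ofReal (T.ratio z.1 k) * 1 := by
            gcongr
            refine tsum_ite_append_le z k fun u _ => ?_
            exact ENNReal.ofReal_le_one.2 (transPow_le_one hs i u w)
        _ = _ := mul_one _
    · rw [indicator_of_notMem hk, zero_add]
      gcongr
      refine tsum_ite_append_le z k fun u hu => ?_
      refine ENNReal.ofReal_le_ofReal ?_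
      by_contra hc
      exact hk ⟨u, hu, (not_le.1 hc).le⟩
  have h3 := h1.trans (ENNReal.tsum_le_tsum h2)
  rw [ENNReal.tsum_add, ENNReal.tsum_mul_right, tsum_ratio z.2.2, one_mul, ← stepLaw_apply] at h3
  have h4 : ENNReal.ofReal δ = ENNReal.ofReal (δ / 2) + ENNReal.ofReal (δ / 2) := by
    rw [← ENNReal.ofReal_add (by positivity) (by positivity)]
    congr 1
    ring
  rw [h4] at h3
  exact (ENNReal.add_le_add_iff_right ENNReal.ofReal_ne_top).1 h3

/-- The source of randomness in one step: a guess of the time, an indicator of success, and a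
uniform random variable. -/
noncomputable def sourceLaw (b : ℕ) (c : ENNReal) : Measure (Fin b × Bool × ℝ) :=
  ((b : ENNReal)⁻¹ • Measure.count).prod
    ((c • Measure.dirac true + (1 - c) • Measure.dirac false).prod unif01)

lemma isProbabilityMeasure_sourceLaw {b : ℕ} (hb : 1 ≤ b) {c : ENNReal} (hc : c < 1) :
    IsProbabilityMeasure (sourceLaw b c) := by
  have h1 : IsProbabilityMeasure ((b : ENNReal)⁻¹ • (Measure.count : Measure (Fin b))) := ⟨by
    have hb0 : (b : ENNReal) ≠ 0 := by simp; omega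
    simp [Measure.count_apply, ENNReal.inv_mul_cancel hb0]⟩
  have h2 : IsProbabilityMeasure (c • Measure.dirac true + (1 - c) • Measure.dirac false) := ⟨by
    simp [add_tsub_cancel_of_le hc.le]⟩
  unfold sourceLaw
  infer_instance

/-- If from every state `w` is reached in `b` steps with probability at least `δ > 0`, then there is
an updating function for which blocks of length `b` lead from all states to `w` simultaneously with
positive probability: the innovations contain guesses of the time, and a step that is taken with the
correct guess tries to keep the probability of reaching `w` in the remaining time large. -/
theorem exists_update_coalProb_pos (hs : 1 ≤ s) {b : ℕ} (hb : 1 ≤ b) (w : T.Adm s) {δ : ℝ}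
    (hδ : 0 < δ) (h : ∀ z, δ ≤ T.transPow s b z w) :
    ∃ g : List 𝒳 → ℝ → 𝒳, T.IsUpdate s g ∧ 0 < T.coalProb s g b := by
  classical
  have hδ1 : δ ≤ 1 := (h w).trans (transPow_le_one hs _ _ _)
  -- The smallest of the levels δ/2^(τ+1) for τ < b, so that one flag probability serves all times.
  set c : ENNReal := ENNReal.ofReal (δ / 2 ^ b) with hc
  have hc0 : c ≠ 0 := by
    rw [hc, Ne, ENNReal.ofReal_eq_zero, not_le]
    positivity
  have hc1 : c < 1 := by
    rw [hc, ENNReal.ofReal_lt_one, div_lt_one (by positivity)]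
    exact hδ1.trans_lt (one_lt_pow₀ one_lt_two (by omega))
  have hq : ∀ (z : T.Adm s) (τ : Fin b), ∃ q₁ q₂ : ℝ → 𝒳, Measurable q₁ ∧ Measurable q₂ ∧
      (c ≤ stepLaw T z.1 (goodDigits T s (b - τ - 1) w (δ / 2 ^ (τ + 1 : ℕ)) z.1) →
        ∀ u, q₁ u ∈ goodDigits T s (b - τ - 1) w (δ / 2 ^ (τ + 1 : ℕ)) z.1) ∧
      c • unif01.map q₁ + (1 - c) • unif01.map q₂ = stepLaw T z.1 := by
    intro z τ
    have := isProbabilityMeasure_stepLaw z.2.2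
    exact exists_mixture _ _ hc0 hc1
  choose q₁ q₂ hq₁ hq₂ hgood hmix using hq
  have := isProbabilityMeasure_sourceLaw hb hc1
  have : Nonempty (Fin b) := ⟨⟨0, hb⟩⟩
  obtain ⟨φ, hφ, hφlaw⟩ := exists_map_unif01_eq (sourceLaw b c)
  let Q : T.Adm s → Fin b × Bool × ℝ → 𝒳 := fun z e =>
    if e.2.1 = true then q₁ z e.1 e.2.2 else q₂ z e.1 e.2.2
  have hQ : ∀ z, Measurable (Q z) := by
    intro z
    refine measurable_from_prod_countable_right fun τ => ?_
    refine measurable_from_prod_countable_right fun y => ?_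
    cases y
    · exact hq₂ z τ
    · exact hq₁ z τ
  have hQlaw : ∀ z k, sourceLaw b c {e | Q z e = k} = ENNReal.ofReal (T.ratio z.1 k) := by
    intro z k
    have hm : MeasurableSet {e | Q z e = k} := hQ z (measurableSet_singleton k)
    -- For each value of the guess the mixture has the correct law, so guessing does not bias the
    -- digit.
    have hin : ∀ τ, ((c • Measure.dirac true + (1 - c) • Measure.dirac false).prod unif01)
        (Prod.mk τ ⁻¹' {e | Q z e = k}) = ENNReal.ofReal (T.ratio z.1 k) := by
      intro τ
      rw [Measure.prod_apply (measurable_prodMk_left hm), lintegral_add_measure,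
        lintegral_smul_measure, lintegral_smul_measure, lintegral_dirac, lintegral_dirac,
        ← stepLaw_singleton, ← hmix z τ, Measure.add_apply, Measure.smul_apply, Measure.smul_apply,
        Measure.map_apply (hq₁ z τ) (measurableSet_singleton k),
        Measure.map_apply (hq₂ z τ) (measurableSet_singleton k)]
      simp only [Q]
      rfl
    have hb0 : (b : ENNReal) ≠ 0 := by simp; omega
    rw [sourceLaw, Measure.prod_apply hm]
    simp_rw [hin]
    simp [mul_comm (b : ENNReal)⁻¹, ENNReal.mul_inv_cancel hb0]
  let g : List 𝒳 → ℝ → 𝒳 := fun z v =>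
    if hz : z.length = s ∧ 0 < T.len z then Q ⟨z, hz⟩ (φ v) else Classical.arbitrary 𝒳
  have hgz : ∀ (z : T.Adm s) v, g z.1 v = Q z (φ v) := fun z v => by
    simp only [g, dif_pos z.2]
  refine ⟨g, ⟨?_, ?_⟩, ?_⟩
  · intro z k
    by_cases hz : z.length = s ∧ 0 < T.len z
    · simp only [g, dif_pos hz]
      exact ((hQ _).comp hφ) (measurableSet_singleton k)
    · simp only [g, dif_neg hz]
      exact .const _
  · intro z k
    simp only [hgz]
    have hm : MeasurableSet {e | Q z e = k} := hQ z (measurableSet_singleton k)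
    rw [← hQlaw, ← hφlaw, Measure.map_apply hφ hm]
    rfl
  -- The event at step `j`: the guess is `j` and the flag is raised.
  · let A : Fin b → Set ℝ := fun j => φ ⁻¹' ({j} ×ˢ ({true} ×ˢ univ))
    have hA : ∀ j, unif01 (A j) ≠ 0 := by
      intro j
      rw [← Measure.map_apply hφ (by measurability), hφlaw, sourceLaw, Measure.prod_prod,
        Measure.prod_prod]
      simp [hc0]
    have hsub : Set.univ.pi A ⊆ {v | T.Coalescent s g v} := by
      intro v hv
      have key : ∀ z : T.Adm s, ∀ j ≤ b, ∃ u : T.Adm s,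
          ((List.ofFn v).take j).foldl (srsStep g) z.1 = u.1 ∧
            δ / 2 ^ j ≤ T.transPow s (b - j) u w := by
        intro z j
        induction j with
        | zero => exact fun _ => ⟨z, by simp, by simpa using h z⟩
        | succ j ih =>
          intro hj
          obtain ⟨u, hu, hu2⟩ := ih (by omega)
          have hj' : j < (List.ofFn v).length := by simp; omega
          rw [show b - j = b - j - 1 + 1 by omega] at hu2
          have h3 := le_stepLaw_goodDigits hs (by positivity) hu2
          have h4 : δ / 2 ^ j / 2 = δ / 2 ^ (j + 1) := by rw [pow_succ]; field_simp
          rw [h4] at h3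
          have h5 : c ≤ ENNReal.ofReal (δ / 2 ^ (j + 1)) := by
            rw [hc]
            refine ENNReal.ofReal_le_ofReal ?_
            gcongr
            · exact one_le_two
          have h6 := hgood u ⟨j, by omega⟩ (h5.trans h3) (φ (v ⟨j, by omega⟩)).2.2
          have h7 : v ⟨j, by omega⟩ ∈ A ⟨j, by omega⟩ := hv _ (mem_univ _)
          simp only [A, mem_preimage, mem_prod, mem_singleton_iff, mem_univ, and_true] at h7
          have h8 : g u.1 (v ⟨j, by omega⟩) =
              q₁ u ⟨j, by omega⟩ (φ (v ⟨j, by omega⟩)).2.2 := by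
            rw [hgz]
            simp only [Q, if_pos h7.2]
            rw [h7.1]
          rw [← h8] at h6
          obtain ⟨u', hu', hu2'⟩ := h6
          refine ⟨u', ?_, by rwa [Nat.sub_sub] at hu2'⟩
          rw [← List.take_append_getElem hj', List.foldl_append, hu]
          simpa [srsStep] using hu'
      have hout : ∀ z : T.Adm s, blockOut g z.1 v = w.1 := by
        intro z
        obtain ⟨u, hu, hu2⟩ := key z b le_rfl
        rw [List.take_of_length_le (by simp)] at hu
        rw [blockOut, hu]
        -- No time remains, and `transPow` at 0 is the identity matrix, so a positive entry forces
        -- the state to be `w`.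
        by_contra hne
        rw [Nat.sub_self, transPow, if_neg fun h => hne (congrArg Subtype.val h)] at hu2
        exact absurd hu2 (not_le.2 (by positivity))
      intro z z'
      rw [hout z, hout z']
    have hpos : 0 < Measure.pi (fun _ : Fin b => unif01) {v | T.Coalescent s g v} := by
      refine lt_of_lt_of_le ?_ (measure_mono hsub)
      rw [Measure.pi_pi]
      exact pos_iff_ne_zero.2 (Finset.prod_ne_zero_iff.2 fun j _ => hA j)
    exact ENNReal.toReal_pos hpos.ne' (measure_ne_top _ _)

/-- There are updating functions with coalescent blocks. -/
theorem IsUnifGeomErgodic.exists_update (hs : 1 ≤ s) {ϖ : T.Adm s → ℝ}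
    (hϖ : T.IsUnifGeomErgodic s ϖ) : ∃ (g : List 𝒳 → ℝ → 𝒳) (t : ℕ), T.IsUpdate s g ∧ s ≤ t ∧
      0 < T.coalProb s g (t + s - 1) := by
  obtain ⟨w, δ, hδ, h⟩ := hϖ.exists_transPow_ge hs
  -- b ≥ 2s ensures that t = b - s + 1, the solution of t + s - 1 = b, is at least s.
  obtain ⟨b, hb, hb2⟩ := (h.and (eventually_ge_atTop (2 * s))).exists
  obtain ⟨g, hg, hpos⟩ := exists_update_coalProb_pos hs (by omega) w hδ hb
  refine ⟨g, b - s + 1, hg, by omega, ?_⟩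
  rwa [show b - s + 1 + s - 1 = b by omega]

end Update

end NestedSubdivision

/-! ### Coalescence of two sequences with common innovations -/

section Recursion

variable {𝒳 : Type*} {s m b : ℕ} {g : List 𝒳 → ℝ → 𝒳} {V : ℕ → ℝ} {d d' : ℕ → 𝒳}

lemma window_eq_foldl (hs : 1 ≤ s) (hm : s ≤ m)
    (hd : ∀ i, d (m + i) = g (window d (m + i - s) s) (V i)) (k j : ℕ) :
    ((List.range j).map fun i => V (k + i)).foldl (srsStep g) (window d (m + k - s) s) =
      window d (m + k + j - s) s := by
  induction j with
  | zero => rfl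
  | succ j ih =>
    rw [List.range_succ, List.map_append, List.foldl_append, ih, List.map_singleton,
      List.foldl_cons, List.foldl_nil, srsStep, show m + k + j - s = m + (k + j) - s by omega, ← hd,
      show m + k + (j + 1) - s = m + (k + j) - s + 1 by omega, ← window_tail_append hs,
      show m + (k + j) - s + s = m + (k + j) by omega]

lemma blockOut_window (hs : 1 ≤ s) (hm : s ≤ m)
    (hd : ∀ i, d (m + i) = g (window d (m + i - s) s) (V i)) (i : ℕ) :
    blockOut g (window d (m + i * b - s) s) (blockInput b V (i + 1)) =
      window d (m + (i + 1) * b - s) s := by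
  have h := window_eq_foldl hs hm hd (i * b) b
  rw [show m + (i + 1) * b - s = m + i * b + b - s by rw [Nat.succ_mul]; omega, ← h, blockOut]
  congr 1
  apply List.ext_getElem
  · simp
  · intro j h1 h2
    simp [blockInput]

/-- The coalescent block leaves both chains in one state, and common innovations keep them together.
That state is the window of s digits starting at m + bM - s, whence the `- s` in K. -/
lemma NestedSubdivision.Coalescent.eq_of_le {T : NestedSubdivision 𝒳} (hs : 1 ≤ s) (hm : s ≤ m)
    (hd : ∀ i, d (m + i) = g (window d (m + i - s) s) (V i))
    (hd' : ∀ i, d' (m + i) = g (window d' (m + i - s) s) (V i))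
    (hpos : ∀ n, 0 < T.len (window d n s)) (hpos' : ∀ n, 0 < T.len (window d' n s)) {M : ℕ}
    (hM : 1 ≤ M) (hC : T.Coalescent s g (blockInput b V M)) {p : ℕ} (hp : m + b * M - s ≤ p) :
    d p = d' p := by
  obtain ⟨M, rfl⟩ := Nat.exists_eq_add_of_le' hM
  have h0 : window d (m + (M + 1) * b - s) s = window d' (m + (M + 1) * b - s) s := by
    rw [← blockOut_window hs hm hd, ← blockOut_window hs hm hd']
    exact hC ⟨_, by simp, hpos _⟩ ⟨_, by simp, hpos' _⟩
  have h1 : ∀ j, window d (m + (M + 1) * b + j - s) s = window d' (m + (M + 1) * b + j - s) s := by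
    intro j
    rw [← window_eq_foldl hs hm hd, ← window_eq_foldl hs hm hd', h0]
  rw [mul_comm] at hp
  obtain ⟨j, rfl⟩ := Nat.exists_eq_add_of_le hp
  have h2 := h1 j
  rw [show m + (M + 1) * b + j - s = m + (M + 1) * b - s + j by omega, window_eq_pre,
    window_eq_pre, pre_eq_pre_iff] at h2
  simpa using h2 0 hs

end Recursion

/-! ### The coupling -/

namespace NestedSubdivision

variable {𝒳 : Type*} [Countable 𝒳] [Nonempty 𝒳] [MeasurableSpace 𝒳] [DiscreteMeasurableSpace 𝒳]
  {T : NestedSubdivision 𝒳} {s : ℕ} {g : List 𝒳 → ℝ → 𝒳} {f : ℝ → ℝ} {H : Set ℝ}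
  {ϖ : T.Adm s → ℝ}

lemma measurableSet_coalescent (hg : T.IsUpdate s g) (b : ℕ) :
    MeasurableSet {v : Fin b → ℝ | T.Coalescent s g v} := by
  have h : ∀ (z : List 𝒳) (j : ℕ), j ≤ b → ∀ l,
      MeasurableSet {v : Fin b → ℝ | ((List.ofFn v).take j).foldl (srsStep g) z = l} := by
    intro z j
    induction j with
    | zero => exact fun _ l => .const (z = l)
    | succ j ih =>
      intro hj l
      have h2 : {v : Fin b → ℝ | ((List.ofFn v).take (j + 1)).foldl (srsStep g) z = l} =
          ⋃ p ∈ {p : List 𝒳 × 𝒳 | p.1.tail ++ [p.2] = l},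
            {v | ((List.ofFn v).take j).foldl (srsStep g) z = p.1} ∩
              (fun v => v ⟨j, hj⟩) ⁻¹' {x | g p.1 x = p.2} := by
        ext v
        have hj' : j < (List.ofFn v).length := by simp; omega
        simp only [← List.take_append_getElem hj', List.foldl_append, List.foldl_cons,
          List.foldl_nil, List.getElem_ofFn, mem_ofPred_eq, mem_iUnion, mem_inter_iff,
          mem_preimage, srsStep]
        constructor
        · exact fun h => ⟨(_, _), h, rfl, rfl⟩
        · rintro ⟨⟨l', k⟩, h1, rfl, h2⟩
          simp only at h1 h2
          rw [h2, h1]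
      rw [h2]
      exact MeasurableSet.biUnion (to_countable _) fun p _ =>
        (ih (by omega) _).inter (measurable_pi_apply _ (hg.measurable _ _))
  have h3 : {v : Fin b → ℝ | T.Coalescent s g v} =
      ⋂ (z : T.Adm s) (z' : T.Adm s), ⋃ l : List 𝒳,
        {v | ((List.ofFn v).take b).foldl (srsStep g) z.1 = l} ∩
        {v | ((List.ofFn v).take b).foldl (srsStep g) z'.1 = l} := by
    ext v
    have h4 : (List.ofFn v).take b = List.ofFn v := List.take_of_length_le (by simp)
    simp [Coalescent, blockOut, h4, eq_comm]
  rw [h3]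
  exact .iInter fun z => .iInter fun z' => .iUnion fun l => (h _ b le_rfl l).inter (h _ b le_rfl l)

/-- The probability space of the coupling: a point with its number of sufficient digits, a point
with the invariant distribution, and the innovations. -/
noncomputable def couplingLaw (T : NestedSubdivision 𝒳) (s : ℕ) (f : ℝ → ℝ) (H : Set ℝ)
    (ϖ : T.Adm s → ℝ) : Measure ((ℝ × ℕ) × ℝ × (ℕ → ℝ)) :=
  (T.jointLaw f H).prod ((T.law (T.pmfDensity s ϖ)).prod unifSeq)

section Coupling

variable [IsProbabilityMeasure (T.jointLaw f H)] [IsProbabilityMeasure (T.law (T.pmfDensity s ϖ))]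

instance : IsProbabilityMeasure (couplingLaw T s f H ϖ) := by unfold couplingLaw; infer_instance

lemma measurable_restart_fst (hg : T.IsUpdate s g) : Measurable
    fun ω : (ℝ × ℕ) × ℝ × (ℕ → ℝ) => restart T s g ω.1.1 ω.1.2 ω.2.2 := by
  have h0 : Measurable fun ω : (ℝ × ℕ) × ℝ × (ℕ → ℝ) => (ω.1, ω.2.2) :=
    measurable_fst.prodMk (measurable_snd.comp measurable_snd)
  have h1 := (measurable_restart hg).comp h0
  simpa only [Function.comp_def] using h1

lemma measurable_restart_snd (hg : T.IsUpdate s g) : Measurable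
    fun ω : (ℝ × ℕ) × ℝ × (ℕ → ℝ) => restart T s g ω.2.1 ω.1.2 ω.2.2 := by
  have h0 : Measurable fun ω : (ℝ × ℕ) × ℝ × (ℕ → ℝ) => ((ω.2.1, ω.1.2), ω.2.2) :=
    ((measurable_fst.comp measurable_snd).prodMk (measurable_snd.comp measurable_fst)).prodMk
      (measurable_snd.comp measurable_snd)
  have h1 := (measurable_restart hg).comp h0
  simpa only [Function.comp_def] using h1

lemma hasLaw_restart_fst (hM : T.IsMarkov s) (hg : T.IsUpdate s g) (hHJ : H ⊆ T.J)
    (hH0 : volume (T.J \ H) = 0) :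
    HasLaw (fun ω : (ℝ × ℕ) × ℝ × (ℕ → ℝ) => (restart T s g ω.1.1 ω.1.2 ω.2.2, ω.1.2))
      (T.jointLaw f H) (couplingLaw T s f H ϖ) := by
  have hm : Measurable fun ω : (ℝ × ℕ) × ℝ × (ℕ → ℝ) =>
      (restart T s g ω.1.1 ω.1.2 ω.2.2, ω.1.2) :=
    (measurable_restart_fst hg).prodMk (measurable_snd.comp measurable_fst)
  refine ⟨hm.aemeasurable, ?_⟩
  ext B hB
  rw [Measure.map_apply hm hB, couplingLaw, Measure.prod_apply (hm hB),
    ← lintegral_jointLaw_restart hM hg hHJ hH0 hB]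
  refine lintegral_congr fun q => ?_
  have h : Prod.mk q ⁻¹' ((fun ω : (ℝ × ℕ) × ℝ × (ℕ → ℝ) =>
      (restart T s g ω.1.1 ω.1.2 ω.2.2, ω.1.2)) ⁻¹' B) =
      univ ×ˢ {V | (restart T s g q.1 q.2 V, q.2) ∈ B} := by
    ext ω
    simp
  rw [h, Measure.prod_prod, measure_univ, one_mul]

lemma hasLaw_restart_snd (hM : T.IsMarkov s) (hg : T.IsUpdate s g) :
    HasLaw (fun ω : (ℝ × ℕ) × ℝ × (ℕ → ℝ) => restart T s g ω.2.1 ω.1.2 ω.2.2)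
      (T.law (T.pmfDensity s ϖ)) (couplingLaw T s f H ϖ) := by
  have hm := measurable_restart_snd hg
  refine ⟨hm.aemeasurable, ?_⟩
  ext A hA
  rw [Measure.map_apply hm hA, couplingLaw, Measure.prod_apply (hm hA)]
  have h : ∀ q : ℝ × ℕ, ((T.law (T.pmfDensity s ϖ)).prod unifSeq) (Prod.mk q ⁻¹'
      ((fun ω : (ℝ × ℕ) × ℝ × (ℕ → ℝ) => restart T s g ω.2.1 ω.1.2 ω.2.2) ⁻¹' A)) =
      T.law (T.pmfDensity s ϖ) A := by
    intro q
    rw [Measure.prod_apply (measurable_prodMk_left (hm hA)),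
      ← lintegral_law_restart hM hg ϖ q.2 hA]
    rfl
  simp_rw [h]
  simp

lemma ae_couplingLaw_mem_digitRange (hM : T.IsMarkov s) (hg : T.IsUpdate s g)
    (hH : MeasurableSet H) (hHJ : H ⊆ T.J) : ∀ᵐ ω ∂(couplingLaw T s f H ϖ),
      extSeq s g (keptDigits T s ω.1.1 ω.1.2) ω.2.2 ∈ T.digitRange ∧
      extSeq s g (keptDigits T s ω.2.1 ω.1.2) ω.2.2 ∈ T.digitRange := by
  have hm1 : Measurable fun ω : (ℝ × ℕ) × ℝ × (ℕ → ℝ) =>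
      extSeq s g (keptDigits T s ω.1.1 ω.1.2) ω.2.2 :=
    measurable_extSeq_comp hg.measurable (fun l => measurable_fst (measurableSet_keptDigits l))
      (measurable_snd.comp measurable_snd)
  have h0 : Measurable fun ω : (ℝ × ℕ) × ℝ × (ℕ → ℝ) => (ω.2.1, ω.1.2) :=
    (measurable_fst.comp measurable_snd).prodMk (measurable_snd.comp measurable_fst)
  have hm2 : Measurable fun ω : (ℝ × ℕ) × ℝ × (ℕ → ℝ) =>
      extSeq s g (keptDigits T s ω.2.1 ω.1.2) ω.2.2 :=
    measurable_extSeq_comp hg.measurable (fun l => h0 (measurableSet_keptDigits l))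
      (measurable_snd.comp measurable_snd)
  have hR := T.measurableSet_digitRange
  have hS : MeasurableSet {ω : (ℝ × ℕ) × ℝ × (ℕ → ℝ) |
      extSeq s g (keptDigits T s ω.1.1 ω.1.2) ω.2.2 ∈ T.digitRange ∧
      extSeq s g (keptDigits T s ω.2.1 ω.1.2) ω.2.2 ∈ T.digitRange} := (hm1 hR).inter (hm2 hR)
  rw [couplingLaw, Measure.ae_prod_iff_ae_ae hS]
  filter_upwards [ae_jointLaw_mem f hH] with q hq
  have hS' := measurable_prodMk_left (x := q) hS
  refine (Measure.ae_prod_iff_ae_ae hS').2 ?_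
  filter_upwards [ae_law_mem_J (T := T) (T.pmfDensity s ϖ)] with x hx
  exact (ae_restart hM hg (hHJ hq) q.2).and (ae_restart hM hg hx q.2)

/-- The head of the point is independent of the innovations. -/
lemma headIndep_restart (hM : T.IsMarkov s) (hg : T.IsUpdate s g)
    (hH : MeasurableSet H) (hHJ : H ⊆ T.J) {β : Type*} [MeasurableSpace β]
    (F : ℝ × (ℕ → ℝ) → β) :
    T.HeadIndep s (couplingLaw T s f H ϖ) (fun ω => restart T s g ω.1.1 ω.1.2 ω.2.2)
      (fun ω => ω.1.2) fun ω => F ω.2 := by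
  rw [HeadIndep, Indep_iff]
  rintro _ _ ⟨A, -, rfl⟩ ⟨B, -, rfl⟩
  let A' : Set (ℝ × ℕ) := {q | (keptDigits T s q.1 q.2, q.2) ∈ A}
  have hae : ((fun ω : (ℝ × ℕ) × ℝ × (ℕ → ℝ) =>
      T.head s (restart T s g ω.1.1 ω.1.2 ω.2.2) ω.1.2) ⁻¹' A : Set _)
      =ᵐ[couplingLaw T s f H ϖ] (A' ×ˢ univ : Set ((ℝ × ℕ) × ℝ × (ℕ → ℝ))) := by
    filter_upwards [ae_couplingLaw_mem_digitRange (ϖ := ϖ) (f := f) hM hg hH hHJ] with ω hω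
    refine propext ?_
    show T.head s (restart T s g ω.1.1 ω.1.2 ω.2.2) ω.1.2 ∈ A ↔ ω ∈ A' ×ˢ univ
    have h1 : T.head s (restart T s g ω.1.1 ω.1.2 ω.2.2) ω.1.2 =
        (keptDigits T s ω.1.1 ω.1.2, ω.1.2) := by
      have h2 := pre_extSeq_length (s := s) (g := g) (w := keptDigits T s ω.1.1 ω.1.2) (V := ω.2.2)
      rw [length_keptDigits] at h2
      rw [head, restart, T.digits_point hω.1, h2]
    rw [h1]
    simp [A']
  have hB' : (fun ω : (ℝ × ℕ) × ℝ × (ℕ → ℝ) => F ω.2) ⁻¹' B = univ ×ˢ (F ⁻¹' B) := by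
    ext ω
    simp
  refine (measure_congr (hae.inter (ae_eq_refl _))).trans ?_
  rw [measure_congr hae, hB', prod_inter_prod,
    inter_univ, univ_inter, couplingLaw, Measure.prod_prod, Measure.prod_prod, Measure.prod_prod,
    measure_univ, measure_univ, one_mul, mul_one]

lemma hasLaw_innovations : HasLaw (fun ω : (ℝ × ℕ) × ℝ × (ℕ → ℝ) => ω.2.2) unifSeq
    (couplingLaw T s f H ϖ) := by
  have h := (measurePreserving_snd (μ := T.law (T.pmfDensity s ϖ)) (ν := unifSeq)).comp
    (measurePreserving_snd (μ := T.jointLaw f H)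
      (ν := (T.law (T.pmfDensity s ϖ)).prod unifSeq))
  exact h.hasLaw

end Coupling

end NestedSubdivision

lemma isGeometric_of_hasLaw {Ω : Type*} [MeasurableSpace Ω] {P : Measure Ω} {M : Ω → ℕ} {b : ℕ}
    {S : Set (Fin b → ℝ)} (hS : MeasurableSet S) (hM : HasLaw M
      (geomLaw (Measure.pi (fun _ => unif01) S) (Measure.pi (fun _ => unif01) Sᶜ)) P) :
    IsGeometric P M ((Measure.pi fun _ : Fin b => unif01).real S) := by
  refine ⟨hM.aemeasurable, ?_, fun m hm => ?_⟩
  · have h : P {ω | M ω = 0} = 0 := by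
      rw [hM.measure_eq (p := fun n => n = 0) (measurableSet_singleton 0)]
      exact (geomLaw_singleton _ _ 0).trans (if_pos rfl)
    refine measure_mono_null (fun ω hω => ?_) h
    simpa using hω
  · rw [hM.measureReal_eq (p := fun n => n = m) (measurableSet_singleton m), measureReal_def]
    refine (congrArg ENNReal.toReal (geomLaw_singleton _ _ m)).trans ?_
    rw [if_neg (by omega), ENNReal.toReal_mul, ENNReal.toReal_pow, ← measureReal_def,
      ← measureReal_def, probReal_compl_eq_one_sub hS]

/-- Probabilities that an integer random variable exceeds `n` tend to zero. -/
lemma tendsto_measureReal_lt {Ω : Type*} [MeasurableSpace Ω] {P : Measure Ω} [IsProbabilityMeasure P]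
    {K : Ω → ℕ} (hK : Measurable K) : Tendsto (fun n => P.real {ω | n < K ω}) atTop (𝓝 0) := by
  have h := tendsto_measure_iInter_atTop (μ := P) (s := fun n : ℕ => {ω | n < K ω})
    (fun n => (hK (measurableSet_Ioi (a := n))).nullMeasurableSet)
    (fun m n hmn ω (hω : n < K ω) => lt_of_le_of_lt hmn hω) ⟨0, measure_ne_top _ _⟩
  have h0 : ⋂ n : ℕ, {ω | n < K ω} = ∅ := by
    rw [eq_empty_iff_forall_notMem]
    exact fun ω hω => lt_irrefl (K ω) (mem_iInter.1 hω (K ω))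
  rw [h0, measure_empty] at h
  exact (ENNReal.tendsto_toReal ENNReal.zero_ne_top).comp h

namespace NestedSubdivision

variable {𝒳 : Type*}

/-- The coupling inequality. -/
lemma tvDist_le_of_ae_eq (T : NestedSubdivision 𝒳) {Ω : Type*} [MeasurableSpace Ω] {P : Measure Ω}
    [IsProbabilityMeasure P] {Y Y' : Ω → ℝ} (hY : AEMeasurable Y P) (hY' : AEMeasurable Y' P)
    {B : Set Ω} (h : ∀ᵐ ω ∂P, ω ∉ B → Y ω = Y' ω) :
    T.tvDist (P.map Y) (P.map Y') ≤ P.real B := by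
  have key : ∀ {Y Y' : Ω → ℝ}, (∀ᵐ ω ∂P, ω ∉ B → Y ω = Y' ω) → ∀ A : Set ℝ,
      P.real (Y ⁻¹' A) ≤ P.real (Y' ⁻¹' A) + P.real B := by
    intro Y Y' h A
    refine le_trans ?_ (measureReal_union_le _ _)
    refine ENNReal.toReal_mono (measure_ne_top _ _) (measure_mono_ae ?_)
    filter_upwards [h] with ω hω (hA : Y ω ∈ A)
    show ω ∈ Y' ⁻¹' A ∪ B
    by_cases hB : ω ∈ B
    · exact Or.inr hB
    · exact Or.inl (show Y' ω ∈ A from hω hB ▸ hA)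
  refine Real.iSup_le (fun ⟨A, hA, _⟩ => ?_) measureReal_nonneg
  simp only
  rw [map_measureReal_apply_of_aemeasurable hY hA, map_measureReal_apply_of_aemeasurable hY' hA,
    abs_le]
  have h1 := key h A
  have h2 := key (h.mono fun ω hω hB => (hω hB).symm) A
  constructor <;> linarith

variable [Countable 𝒳] [Nonempty 𝒳] [MeasurableSpace 𝒳] [DiscreteMeasurableSpace 𝒳]
  {T : NestedSubdivision 𝒳} {s : ℕ} {g : List 𝒳 → ℝ → 𝒳} {f : ℝ → ℝ} {H : Set ℝ}
  {ϖ : T.Adm s → ℝ}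

lemma extSeq_keptDigits_recursion (x : ℝ) (n : ℕ) (V : ℕ → ℝ) (i : ℕ) :
    extSeq s g (keptDigits T s x n) V (max n s + i) =
      g (window (extSeq s g (keptDigits T s x n) V) (max n s + i - s) s) (V i) := by
  have h := extSeq_apply (s := s) (g := g) (w := keptDigits T s x n) (V := V) (by simp) i
  rwa [length_keptDigits] at h

lemma IsMarkov.len_window_pos_of_mem_digitRange (hM : T.IsMarkov s) {d : ℕ → 𝒳}
    (hd : d ∈ T.digitRange) (n : ℕ) : 0 < T.len (window d n s) :=
  hM.len_window_pos (T.len_pos_of_nonempty ⟨_, T.mem_digitRange_iff.1 hd _⟩)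

theorem exists_readOnceCoupling (hs : 1 ≤ s) (hM : T.IsMarkov s) (hf : T.IsPDF f)
    (hH : MeasurableSet H) (hHJ : H ⊆ T.J) (hH0 : volume (T.J \ H) = 0)
    (hLSC : LowerSemicontinuousOn f H) (hϖ : T.IsInvariantPMF s ϖ) (hg : T.IsUpdate s g) {b : ℕ}
    (hb : 1 ≤ b) (hpos : 0 < T.coalProb s g b) :
    ∃ (Ω : Type) (_ : MeasurableSpace Ω) (P : Measure Ω) (_ : IsProbabilityMeasure P)
      (X : Ω → ℝ) (N : Ω → ℕ) (V : ℕ → Ω → ℝ) (M₁ M₂ K : Ω → ℕ) (Z : Ω → ℝ),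
      T.IsReadOnceCoupling s f H g b P X N V M₁ M₂ ∧
      IsGeometric P M₁ (T.coalProb s g b) ∧
      IsGeometric P M₂ (T.coalProb s g b) ∧
      IndepFun M₁ M₂ P ∧
      T.HeadIndep s P X N (fun ω => (M₁ ω, M₂ ω)) ∧
      (∀ ω, K ω = max (N ω) s + b * (M₁ ω + M₂ ω - 1) - s) ∧
      HasLaw Z (T.law (T.pmfDensity s ϖ)) P ∧
      (∀ᵐ ω ∂P, ∀ n, K ω + s ≤ n → T.rem n (X ω) = T.rem n (Z ω)) ∧
      (∀ n, T.tvDist (P.map (fun ω => T.rem n (X ω))) (T.law (T.pmfDensity s ϖ)) ≤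
        P.real {ω | n < K ω}) ∧
      Tendsto (fun n => P.real {ω | n < K ω}) atTop (𝓝 0) := by
  have := isProbabilityMeasure_jointLaw hf hH hHJ hH0 hLSC
  have := hϖ.isProbabilityMeasure
  let S : Set (Fin b → ℝ) := {v | T.Coalescent s g v}
  have hS : MeasurableSet S := measurableSet_coalescent hg b
  have hS0 : Measure.pi (fun _ => unif01) S ≠ 0 := by
    intro h
    rw [coalProb, measureReal_def, h] at hpos
    simp at hpos
  let P := couplingLaw T s f H ϖ
  let X : (ℝ × ℕ) × ℝ × (ℕ → ℝ) → ℝ := fun ω => restart T s g ω.1.1 ω.1.2 ω.2.2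
  let N : (ℝ × ℕ) × ℝ × (ℕ → ℝ) → ℕ := fun ω => ω.1.2
  let V : ℕ → (ℝ × ℕ) × ℝ × (ℕ → ℝ) → ℝ := fun i ω => ω.2.2 i
  let M₁ : (ℝ × ℕ) × ℝ × (ℕ → ℝ) → ℕ := fun ω => firstBlock S ω.2.2
  let M₂ : (ℝ × ℕ) × ℝ × (ℕ → ℝ) → ℕ := fun ω => secondBlock S ω.2.2
  let K : (ℝ × ℕ) × ℝ × (ℕ → ℝ) → ℕ := fun ω => max (N ω) s + b * (M₁ ω + M₂ ω - 1) - s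
  let Z : (ℝ × ℕ) × ℝ × (ℕ → ℝ) → ℝ := fun ω => restart T s g ω.2.1 ω.1.2 ω.2.2
  have hXN : HasLaw (fun ω => (X ω, N ω)) (T.jointLaw f H) P := hasLaw_restart_fst hM hg hHJ hH0
  have hX : HasLaw X (T.law f) P :=
    HasLaw.fun_comp (Y := Prod.fst)
      ⟨measurable_fst.aemeasurable, jointLaw_map_fst hf hH hHJ hH0 hLSC⟩ hXN
  have hZ : HasLaw Z (T.law (T.pmfDensity s ϖ)) P := hasLaw_restart_snd hM hg
  have hVseq : HasLaw (fun ω i => V i ω) unifSeq P := hasLaw_innovations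
  have hV : ∀ i, HasLaw (V i) unif01 P := fun i =>
    HasLaw.fun_comp (Y := fun V : ℕ → ℝ => V i)
      ⟨(measurable_pi_apply i).aemeasurable, Measure.infinitePi_map_eval _ i⟩ hVseq
  have hViid : iIndepFun V P :=
    (iIndepFun_iff_hasLaw_Pi_infinitePi hV hVseq.aemeasurable).2 hVseq
  have hm₁ : Measurable M₁ :=
    (measurable_firstBlock hS).comp (measurable_snd.comp measurable_snd)
  have hm₂ : Measurable M₂ :=
    (measurable_secondBlock hS).comp (measurable_snd.comp measurable_snd)
  let γ := geomLaw (Measure.pi (fun _ => unif01) S) (Measure.pi (fun _ => unif01) Sᶜ)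
  have : IsProbabilityMeasure γ := isProbabilityMeasure_geomLaw hS0 (prob_add_prob_compl hS)
  have hMM : HasLaw (fun ω => (M₁ ω, M₂ ω)) (γ.prod γ) P :=
    HasLaw.fun_comp (Y := fun V => (firstBlock S V, secondBlock S V))
      ⟨((measurable_firstBlock hS).prodMk (measurable_secondBlock hS)).aemeasurable,
        unifSeq_map_firstBlock_secondBlock hb hS hS0⟩ hVseq
  have hM₁ : HasLaw M₁ γ P := HasLaw.fun_comp (Y := Prod.fst) measurePreserving_fst.hasLaw hMM
  have hM₂ : HasLaw M₂ γ P := HasLaw.fun_comp (Y := Prod.snd) measurePreserving_snd.hasLaw hMM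
  have hG₁ : IsGeometric P M₁ (T.coalProb s g b) := isGeometric_of_hasLaw hS hM₁
  have hG₂ : IsGeometric P M₂ (T.coalProb s g b) := isGeometric_of_hasLaw hS hM₂
  have hdig := ae_couplingLaw_mem_digitRange (ϖ := ϖ) (f := f) hM hg hH hHJ
  have hcoup : ∀ᵐ ω ∂P, ∀ n, K ω ≤ n → T.rem n (X ω) = T.rem n (Z ω) := by
    filter_upwards [hdig, hG₁.2.1, hG₂.2.1] with ω hω h₁ h₂ n hn
    have hC : T.Coalescent s g (blockInput b ω.2.2 (M₁ ω)) :=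
      ((blocks_iff h₁ h₂).1 ⟨rfl, rfl⟩ (M₁ ω) h₁ (by omega)).2 (Or.inl rfl)
    have hK : max (N ω) s + b * M₁ ω - s ≤ n := by
      refine le_trans ?_ hn
      have : b * M₁ ω ≤ b * (M₁ ω + M₂ ω - 1) := Nat.mul_le_mul_left b (by omega)
      show _ ≤ max (N ω) s + b * (M₁ ω + M₂ ω - 1) - s
      omega
    have hd : ∀ p, max (N ω) s + b * M₁ ω - s ≤ p → T.digits (X ω) p = T.digits (Z ω) p := by
      intro p hp
      rw [show T.digits (X ω) = _ from T.digits_point hω.1,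
        show T.digits (Z ω) = _ from T.digits_point hω.2]
      exact hC.eq_of_le hs (le_max_right _ _) (extSeq_keptDigits_recursion _ _ _)
        (extSeq_keptDigits_recursion _ _ _) (hM.len_window_pos_of_mem_digitRange hω.1)
        (hM.len_window_pos_of_mem_digitRange hω.2) h₁ hp
    unfold rem
    congr 1
    funext i
    exact hd _ (by omega)
  have hKm : Measurable K := by
    have h : Measurable fun q : ℕ × ℕ × ℕ => max q.1 s + b * (q.2.1 + q.2.2 - 1) - s :=
      measurable_of_countable _
    exact h.comp ((measurable_snd.comp measurable_fst).prodMk (hm₁.prodMk hm₂))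
  refine ⟨(ℝ × ℕ) × ℝ × (ℕ → ℝ), inferInstance, P, inferInstanceAs (IsProbabilityMeasure
    (couplingLaw T s f H ϖ)), X, N, V, M₁, M₂, K, Z, ⟨hX, hXN, hV, hViid, ?_, ?_, ?_⟩, hG₁, hG₂, ?_,
    ?_, fun _ => rfl, hZ, ?_, fun n => ?_, tendsto_measureReal_lt hKm⟩
  · exact headIndep_restart hM hg hH hHJ Prod.snd
  · filter_upwards [hdig] with ω hω i
    rw [show T.digits (X ω) = _ from T.digits_point hω.1]
    exact extSeq_keptDigits_recursion _ _ _ i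
  · filter_upwards [hG₁.2.1, hG₂.2.1] with ω h₁ h₂
    exact ⟨h₁, h₂, (blocks_iff h₁ h₂).1 ⟨rfl, rfl⟩⟩
  · rw [indepFun_iff_map_prod_eq_prod_map_map hm₁.aemeasurable hm₂.aemeasurable, hMM.map_eq,
      hM₁.map_eq, hM₂.map_eq]
  · exact headIndep_restart hM hg hH hHJ fun q => (firstBlock S q.2, secondBlock S q.2)
  · filter_upwards [hcoup] with ω hω n hn
    exact hω n (by omega)
  · have hrem : P.map (fun ω => T.rem n (Z ω)) = T.law (T.pmfDensity s ϖ) :=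
      (HasLaw.fun_comp ⟨(T.measurable_rem n).aemeasurable, hϖ.map_rem hM hs n⟩ hZ).map_eq
    rw [← hrem]
    refine T.tvDist_le_of_ae_eq ((T.measurable_rem n).comp_aemeasurable hX.aemeasurable)
      ((T.measurable_rem n).comp_aemeasurable hZ.aemeasurable) ?_
    filter_upwards [hcoup] with ω hω hn
    exact hω n (not_lt.1 hn)

end NestedSubdivision

theorem corollary5 {𝒳 : Type*} [Countable 𝒳] [Nonempty 𝒳] (T : NestedSubdivision 𝒳)
    (s : ℕ) (hs : 1 ≤ s) (hMC : T.IsMarkov s)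
    (f : ℝ → ℝ) (hf : T.IsPDF f)
    (H : Set ℝ) (hH : MeasurableSet H) (hHJ : H ⊆ T.J) (hH0 : volume (T.J \ H) = 0)
    (hLSC : LowerSemicontinuousOn f H)
    (ϖ : T.Adm s → ℝ) (hϖ : T.IsUnifGeomErgodic s ϖ) :
    -- the remainders are well defined almost everywhere
    (∀ n, AEMeasurable (T.rem n) (volume.restrict T.J) ∧
      ∀ᵐ x ∂(volume.restrict T.J), T.rem n x ∈ T.J ∧
        ∀ i, T.digits (T.rem n x) i = T.digits x (n + i)) ∧
    -- coalescent blocks have positive probability for suitable `g` and `t`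
    (∃ (g : List 𝒳 → ℝ → 𝒳) (t : ℕ), T.IsUpdate s g ∧ s ≤ t ∧
      0 < T.coalProb s g (t + s - 1)) ∧
    -- for all such `g` and `t`, the coupling exists
    (∀ (g : List 𝒳 → ℝ → 𝒳) (t : ℕ), T.IsUpdate s g → s ≤ t →
      0 < T.coalProb s g (t + s - 1) →
      ∃ (Ω : Type) (_ : MeasurableSpace Ω) (P : Measure Ω) (_ : IsProbabilityMeasure P)
        (X : Ω → ℝ) (N : Ω → ℕ) (V : ℕ → Ω → ℝ) (M₁ M₂ K : Ω → ℕ) (Z : Ω → ℝ),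
        T.IsReadOnceCoupling s f H g (t + s - 1) P X N V M₁ M₂ ∧
        IsGeometric P M₁ (T.coalProb s g (t + s - 1)) ∧
        IsGeometric P M₂ (T.coalProb s g (t + s - 1)) ∧
        IndepFun M₁ M₂ P ∧
        T.HeadIndep s P X N (fun ω => (M₁ ω, M₂ ω)) ∧
        (∀ ω, K ω = max (N ω) s + (t + s - 1) * (M₁ ω + M₂ ω - 1) - s) ∧
        HasLaw Z (T.law (T.pmfDensity s ϖ)) P ∧
        (∀ᵐ ω ∂P, ∀ n, K ω + s ≤ n → T.rem n (X ω) = T.rem n (Z ω)) ∧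
        (∀ n, T.tvDist (P.map (fun ω => T.rem n (X ω))) (T.law (T.pmfDensity s ϖ)) ≤
          P.real {ω | n < K ω}) ∧
        Tendsto (fun n => P.real {ω | n < K ω}) atTop (𝓝 0)) := by
  let _ : MeasurableSpace 𝒳 := ⊤
  have : DiscreteMeasurableSpace 𝒳 := ⟨fun _ => trivial⟩
  refine ⟨fun n => ⟨(T.measurable_rem n).aemeasurable, ?_⟩, hϖ.exists_update hs,
    fun g t hg ht hpos => NestedSubdivision.exists_readOnceCoupling hs hMC hf hH hHJ hH0 hLSC hϖ.isInvariant hg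
      (by omega) hpos⟩
  filter_upwards [hMC.ae_shift_mem_digitRange n] with x hx
  exact ⟨T.point_mem_J hx, fun i => congrFun (T.digits_point hx) i⟩
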